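/- **Proposition 2.1.** Let $X=(X_t)_{t\ge 0}$ be a real Lévy process with $P(X_0=0)=1$ and Lévy–Khinchine triplet $(A,\gamma,\nu)$, i.e. $E\,e^{izX_t}=e^{-t\lambda(z)}$ for $t\ge 0$, $z\in\mathbb R$, where $A\ge 0$, $\gamma\in\mathbb R$, and $$\lambda(z)=\tfrac12Az^2-i\gamma z-\int_{\mathbb R}\bigl(e^{ixz}-1-ixz\,1_{\{|x|\le1\}}\bigr)\,d\nu(x),\qquad \int_{\mathbb R}\frac{x^2}{1+x^2}\,d\nu(x)<\infty .$$ Let $C_0$ be the space of continuous functions on $\mathbb R$ vanishing at infinity, with the supremum norm, let $P_tf(x)=E f(x+X_t)$ for $f\in C_0$, and let $L$ be the infinitesimal generator of $(P_t)_{t\ge 0}$ on $C_0$. Let $C_0^2$ be the set of twice continuously differentiable $f$ with $f,f',f''\in C_0$. Suppose that $d\nu(y)=\nu'(y)\,dy$ with a measurable density $\nu'\ge 0$, and that there are $C>0$ and $0<\alpha<2$, $\alpha\ne1$, with $$\nu'(y)\le C|y|^{-\alpha-1}\qquad(y\ne0).$$ Then $L$ admits the convolution representation $$Lf=\frac{d}{dx}\,S\,\frac{d}{dx}f,\qquad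 Sg(x)=\tfrac12A\,g(x)+\int_{-\infty}^{\infty}k(y-x)\,g(y)\,dy,\qquad \int_{-M}^{M}|k(t)|\,dt<\infty\quad(0<M<\infty),$$ in the following sense: every $f\in C_0^2$ is in the domain of $L$; if $f\in C_0^2$ and $\int|k(y-x)f'(y)|\,dy<\infty$ for every $x\in\mathbb R$, then $Sf'$ is differentiable on $\mathbb R$ with $(Sf')'=Lf$; and this integrability condition holds for every compactly supported $f\in C_0^2$. The kernel $k$ is the following, with $p_0(y)=-\tfrac12\operatorname{sign}(y)$. (a) If $1<\alpha<2$, then $k=k_0+(\gamma-\Gamma)p_0$, where $$k_0(y)=\int_{-\infty}^{y}(y-t)\nu'(t)\,dt\;1_{\{y<0\}}+\int_{y}^{\infty}(t-y)\nu'(t)\,dt\;1_{\{y>0\}},\qquad \Gamma=k_0(-1)+k_0'(-1)-k_0(1)+k_0'(1).$$ (b) If $0<\alpha<1$, then $k=k_0+\gamma_0p_0$, where $\gamma_0=\gamma-\int_{-1}^{1}t\,\nu'(t)\,dt$ is the drift of the process, $k_0(0)=0$ and $$k_0(y)=y\int_{-\infty}^{y}\nu'(t)\,dt+\int_{y}^{0}t\,\nu'(t)\,dt\quad(y<0),\qquad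 k_0(y)=-y\int_{y}^{\infty}\nu'(t)\,dt-\int_{0}^{y}t\,\nu'(t)\,dt\quad(y>0).$$ -/

import Mathlib

open MeasureTheory ProbabilityTheory Filter Topology Set
open scoped NNReal ENNReal ZeroAtInfty

noncomputable section

namespace LevyConv

/-- A real Lévy process started at `0`: independent and stationary increments, continuous in
probability. (Regularity of the paths is irrelevant for the transition semigroup.) -/
structure IsLevyProcess {Ω : Type*} [MeasurableSpace Ω] (P : Measure Ω) (X : ℝ≥0 → Ω → ℝ) :
    Prop where
  measurable : ∀ t, Measurable (X t)
  start_zero : ∀ᵐ ω ∂P, X 0 ω = 0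
  indep : HasIndepIncrements X P
  stationary : ∀ s t : ℝ≥0,
    IdentDistrib (fun ω => X (s + t) ω - X s ω) (fun ω => X t ω - X 0 ω) P P
  stochCont : ∀ t : ℝ≥0, TendstoInMeasure P X (𝓝 t) (X t)

/-- A Lévy measure on the line: no mass at `0` and `∫ x² / (1 + x²) dν < ∞`. -/
def IsLevyMeasure (ν : Measure ℝ) : Prop :=
  ν {0} = 0 ∧ ∫⁻ x, ENNReal.ofReal (x ^ 2 / (1 + x ^ 2)) ∂ν < ∞

/-- The exponent
`λ(z) = A z² / 2 - i γ z - ∫ (exp (i x z) - 1 - i x z 1_{|x| ≤ 1}) dν(x)`. -/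
def levyExponent (A γ : ℝ) (ν : Measure ℝ) (z : ℝ) : ℂ :=
  (1 / 2 : ℂ) * A * z ^ 2 - Complex.I * γ * z
    - ∫ x : ℝ, (Complex.exp (Complex.I * x * z) - 1
        - (Icc (-1 : ℝ) 1).indicator (fun x : ℝ => Complex.I * x * z) x) ∂ν

/-- `(A, γ, ν)` is the Lévy–Khinchine triplet of `X`: `E exp (i z X_t) = exp (-t λ(z))`. -/
structure HasLevyTriplet {Ω : Type*} [MeasurableSpace Ω] (P : Measure Ω) (X : ℝ≥0 → Ω → ℝ)
    (A γ : ℝ) (ν : Measure ℝ) : Prop where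
  nonneg : 0 ≤ A
  levyMeasure : IsLevyMeasure ν
  charFun_eq : ∀ (t : ℝ≥0) (z : ℝ),
    ∫ ω, Complex.exp (Complex.I * z * X t ω) ∂P = Complex.exp (-t * levyExponent A γ ν z)

/-- For a finite measure `μ` on the line, the operator `f ↦ ∫ f (· + y) dμ(y)` on `C₀(ℝ)`. -/
def translationAverage (μ : Measure ℝ) [IsFiniteMeasure μ] : C₀(ℝ, ℝ) →ₗ[ℝ] C₀(ℝ, ℝ) where
  toFun f :=
    { toFun := fun x => ∫ y, f (x + y) ∂μ
      continuous_toFun := by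
        obtain ⟨C, hC⟩ := f.isBounded_range.exists_norm_le
        refine continuous_of_dominated (bound := fun _ => C) ?_ ?_ (integrable_const C) ?_
        · intro x
          exact (f.continuous.comp (continuous_const.add continuous_id)).aestronglyMeasurable
        · intro x
          exact Eventually.of_forall fun y => hC _ ⟨x + y, rfl⟩
        · exact Eventually.of_forall fun y =>
            f.continuous.comp (continuous_id.add continuous_const)
      zero_at_infty' := by
        obtain ⟨C, hC⟩ := f.isBounded_range.exists_norm_le
        have hc : (cocompact ℝ).IsCountablyGenerated := by
          rw [cocompact_eq_atBot_atTop]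
          infer_instance
        have h : Tendsto (fun x => ∫ y, f (x + y) ∂μ) (cocompact ℝ) (𝓝 (∫ _y, (0 : ℝ) ∂μ)) := by
          refine tendsto_integral_filter_of_dominated_convergence (fun _ => C) ?_ ?_
            (integrable_const C) ?_
          · exact Eventually.of_forall fun x =>
              (f.continuous.comp (continuous_const.add continuous_id)).aestronglyMeasurable
          · exact Eventually.of_forall fun x => Eventually.of_forall fun y => hC _ ⟨x + y, rfl⟩
          · exact Eventually.of_forall fun y =>
              (zero_at_infty f).comp (Homeomorph.addRight y).isClosedEmbedding.tendsto_cocompact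
        simpa using h }
  map_add' f g := by
    ext x
    have hi : ∀ f : C₀(ℝ, ℝ), Integrable (fun y => f (x + y)) μ := by
      intro f
      obtain ⟨C, hC⟩ := f.isBounded_range.exists_norm_le
      exact Integrable.of_bound
        (f.continuous.comp (continuous_const.add continuous_id)).aestronglyMeasurable C
        (Eventually.of_forall fun y => hC _ ⟨x + y, rfl⟩)
    exact integral_add (hi f) (hi g)
  map_smul' c f := by
    ext x
    exact integral_const_mul c fun y => f (x + y)

/-- The transition operators of `X`: `(P_t f)(x) = ∫ f(y) P_t(x, dy) = E f(x + X_t)`, where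
`P_t(x, ·)` is the law of the process at time `t` when it is started at `x`. -/
def transitionOp {Ω : Type*} [MeasurableSpace Ω] (P : Measure Ω) [IsFiniteMeasure P]
    (X : ℝ≥0 → Ω → ℝ) (t : ℝ≥0) : C₀(ℝ, ℝ) →ₗ[ℝ] C₀(ℝ, ℝ) :=
  translationAverage (P.map (X t))

/-- `g` is the limit of `(T_t f - f) / t` in `C₀(ℝ)` (that is, in supremum norm) as `t ↓ 0`. -/
def IsGeneratorLimit (T : ℝ≥0 → C₀(ℝ, ℝ) →ₗ[ℝ] C₀(ℝ, ℝ)) (f g : C₀(ℝ, ℝ)) : Prop :=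
  Tendsto (fun t : ℝ≥0 => (t : ℝ)⁻¹ • (T t f - f)) (𝓝[>] 0) (𝓝 g)

/-- The infinitesimal generator of a family of operators on `C₀(ℝ)`, with its natural domain. -/
def generator (T : ℝ≥0 → C₀(ℝ, ℝ) →ₗ[ℝ] C₀(ℝ, ℝ)) : C₀(ℝ, ℝ) →ₗ.[ℝ] C₀(ℝ, ℝ) where
  domain :=
    { carrier := {f | ∃ g, IsGeneratorLimit T f g}
      add_mem' := by
        rintro f₁ f₂ ⟨g₁, h₁⟩ ⟨g₂, h₂⟩
        refine ⟨g₁ + g₂, (h₁.add h₂).congr fun t => ?_⟩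
        ext x
        simp only [map_add, ZeroAtInftyContinuousMap.coe_add, ZeroAtInftyContinuousMap.coe_sub,
          ZeroAtInftyContinuousMap.coe_smul, Pi.add_apply, Pi.sub_apply, Pi.smul_apply, smul_eq_mul]
        ring
      zero_mem' := ⟨0, by simp [IsGeneratorLimit]⟩
      smul_mem' := by
        rintro c f ⟨g, h⟩
        refine ⟨c • g, (h.const_smul c).congr fun t => ?_⟩
        ext x
        simp only [map_smul, ZeroAtInftyContinuousMap.coe_sub,
          ZeroAtInftyContinuousMap.coe_smul, Pi.sub_apply, Pi.smul_apply, smul_eq_mul]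
        ring }
  toFun :=
    { toFun := fun f => f.2.choose
      map_add' := by
        intro f₁ f₂
        refine tendsto_nhds_unique (f₁ + f₂).2.choose_spec
          ((f₁.2.choose_spec.add f₂.2.choose_spec).congr fun t => ?_)
        ext x
        simp only [Submodule.coe_add, map_add, ZeroAtInftyContinuousMap.coe_add,
          ZeroAtInftyContinuousMap.coe_sub, ZeroAtInftyContinuousMap.coe_smul, Pi.add_apply,
          Pi.sub_apply, Pi.smul_apply, smul_eq_mul]
        ring
      map_smul' := by
        intro c f
        refine tendsto_nhds_unique (c • f).2.choose_spec
          ((f.2.choose_spec.const_smul c).congr fun t => ?_)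
        ext x
        simp only [Submodule.coe_smul, map_smul, ZeroAtInftyContinuousMap.coe_sub,
          ZeroAtInftyContinuousMap.coe_smul, Pi.sub_apply, Pi.smul_apply, smul_eq_mul]
        ring }

theorem generator_spec (T : ℝ≥0 → C₀(ℝ, ℝ) →ₗ[ℝ] C₀(ℝ, ℝ)) (f : (generator T).domain) :
    IsGeneratorLimit T f (generator T f) :=
  f.2.choose_spec

/-- `f ∈ C₀ⁿ`: `f` is `n` times continuously differentiable, and `f` and its derivatives up to
order `n` tend to `0` at infinity. -/
def IsC0n (n : ℕ) (f : ℝ → ℝ) : Prop :=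
  ContDiff ℝ n f ∧ ∀ j ≤ n, Tendsto (iteratedDeriv j f) (cocompact ℝ) (𝓝 0)

/-- `(S g)(x) = A g(x) / 2 + ∫ k(y - x) g(y) dy`. -/
def convOp (A : ℝ) (k : ℝ → ℝ) (g : ℝ → ℝ) (x : ℝ) : ℝ :=
  1 / 2 * A * g x + ∫ y, k (y - x) * g y

/-- The integral defining `S g` converges absolutely at every point. -/
def ConvConverges (k : ℝ → ℝ) (g : ℝ → ℝ) : Prop :=
  ∀ x, Integrable (fun y => k (y - x) * g y)

/-- `L` admits the representation `L f = (d/dx) S (d/dx) f` with `S = convOp A k`: the kernel is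
integrable on bounded intervals; `S f'` is defined for all compactly supported `f ∈ C₀²`; every
`f ∈ C₀²` is in the domain of `L`, and whenever the integral defining `S f'` converges
absolutely, `S f'` is differentiable with derivative `L f`. -/
structure HasConvolutionForm (L : C₀(ℝ, ℝ) →ₗ.[ℝ] C₀(ℝ, ℝ)) (A : ℝ) (k : ℝ → ℝ) : Prop where
  locallyIntegrable : ∀ M : ℝ, 0 < M → IntegrableOn k (Icc (-M) M)
  converges : ∀ f : C₀(ℝ, ℝ), IsC0n 2 f → HasCompactSupport f → ConvConverges k (deriv f)
  representation : ∀ f : C₀(ℝ, ℝ), IsC0n 2 f → ∃ hf : f ∈ L.domain,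
    ConvConverges k (deriv f) →
      ∀ x, HasDerivAt (convOp A k (deriv f)) (L ⟨f, hf⟩ x) x

/-- The kernel of `S` that represents `d/dx`: `(d/dx) ∫ p₀(y - x) f'(y) dy = f'(x)`. -/
def p0 (x : ℝ) : ℝ := -(1 / 2) * Real.sign x

/-- The kernel `k₀` for `1 < α < 2`, where `n` is the Lévy density. -/
def k0High (n : ℝ → ℝ) (y : ℝ) : ℝ :=
  (if y < 0 then ∫ t in Iio y, (y - t) * n t else 0)
    + (if 0 < y then ∫ t in Ioi y, (t - y) * n t else 0)

/-- `Γ = k₀(-1) + k₀'(-1) - k₀(1) + k₀'(1)`. -/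
def bigGamma (n : ℝ → ℝ) : ℝ :=
  k0High n (-1) + deriv (k0High n) (-1) - k0High n 1 + deriv (k0High n) 1

/-- The kernel `k₀` for `0 < α < 1`, where `n` is the Lévy density. -/
def k0Low (n : ℝ → ℝ) (y : ℝ) : ℝ :=
  (if y < 0 then y * (∫ t in Iio y, n t) + ∫ t in Ioo y 0, t * n t else 0)
    + (if 0 < y then -(y * ∫ t in Ioi y, n t) - ∫ t in Ioo 0 y, t * n t else 0)

/-- The drift `γ₀ = γ - ∫_{|t| ≤ 1} t n(t) dt`: the coefficient of `f'` in the generator when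
its integral part is written without compensation, as `∫ (f(x + y) - f(x)) n(y) dy`. -/
def drift (γ : ℝ) (n : ℝ → ℝ) : ℝ := γ - ∫ t in Icc (-1 : ℝ) 1, t * n t

end LevyConv

end

/-!
The proof has two independent halves.

*The generator on `C₀²`.* Let `μ_t` be the law of `X_t` and `D_t f = (P_t f - f) / t`. On a Fourier
integral `g(x) = ∫ exp (i ξ x) h(ξ) dξ` the operator `P_t` multiplies `h` by `exp (-t λ)`. As
`Re λ ≥ 0` and `|λ(ξ)| ≤ c (1 + ξ²)`, dominated convergence gives `D_t g → L g` uniformly when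
`(1 + ξ²) h(ξ)` is integrable, where
`L f = A f'' / 2 + γ f' + ∫ (f(x + y) - f(x) - y f'(x) 1_{|y| ≤ 1}) dν(y)` is `levyOp`
(`IsFourierIntegral.eventually_abs_quotient_sub_le`). Such `g` include all smooth compactly
supported functions, which are dense in `C₀²` for the `C²` norm (`exists_smooth_c2Bounded_sub`).
Applying the first step to `(1 - y²) χ(y)` and `y χ(y)`, with `χ` a smooth cutoff, bounds the
truncated moments of `μ_t` by `O(t)`, so that the `D_t` are bounded uniformly in `t` from the `C²`
norm to the supremum norm (`IsLevyFamily.exists_abs_integral_sub_le`). Hence `D_t f → L f` uniformly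
for every `f ∈ C₀²` (`exists_mem_domain_generator`).

*The kernel.* The jumps to the right and to the left are treated separately; reflection exchanges
them. For `u > 0` the kernel `k₀` is `∫_u^∞ (t - u) n(t) dt` (`tailKernel`) if `α > 1`, and
`-∫_0^∞ min(t, u) n(t) dt` (`-minKernel`) if `α < 1`. With `Φ` a primitive of `f`, Fubini's theorem
and integration by parts turn `∫_0^∞ k₀(u) f'(x + u) du` into
`∫_0^∞ (Φ(x + t) - Φ(x) - t f(x)) n(t) dt` and `∫_0^∞ (Φ(x + t) - Φ(x)) n(t) dt` respectively, which
can be differentiated under the integral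
sign (`hasDerivAt_integral_tailKernel`, `hasDerivAt_integral_minKernel`). Absolute convergence of the
convolution is all that Fubini's theorem needs, as the integrands defining `k₀` have one sign. The full
kernel on the half-line is `k₀` plus a constant, and the two may be separated only if `f'` is
integrable. If the full kernel does not tend to `0` at infinity, this follows from the convergence
of the convolution. If it does tend to `0`, it is equal to `tailKernel`, and no separation is needed.
The constants `Γ` and `γ₀` collect the drift that results from truncating the compensator at
`|y| = 1` (`bigGamma_eq`, `drift_eq`).
-/

noncomputable section

namespace LevyConv

/-! ### Lévy measures and compensated increments -/

section

/-- The weight `y² / (1 + y²)` against which Lévy measures are finite. -/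
def levyWeight (y : ℝ) : ℝ := y ^ 2 / (1 + y ^ 2)

theorem levyWeight_nonneg (y : ℝ) : 0 ≤ levyWeight y := by
  unfold levyWeight; positivity

theorem sq_le_levyWeight {y : ℝ} (hy : y ∈ Icc (-1 : ℝ) 1) : y ^ 2 ≤ 2 * levyWeight y := by
  have h1 : y ^ 2 ≤ 1 := by nlinarith [hy.1, hy.2]
  unfold levyWeight
  rw [← mul_div_assoc, le_div_iff₀ (by positivity)]
  nlinarith [sq_nonneg y]

theorem one_le_levyWeight {y : ℝ} (hy : y ∉ Icc (-1 : ℝ) 1) : 1 ≤ 2 * levyWeight y := by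
  have h1 : 1 ≤ y ^ 2 := by
    by_contra! h
    exact hy ⟨by nlinarith, by nlinarith⟩
  unfold levyWeight
  rw [← mul_div_assoc, le_div_iff₀ (by positivity)]
  linarith

theorem continuous_levyWeight : Continuous levyWeight := by
  unfold levyWeight
  exact (continuous_pow 2).div (by fun_prop) fun y => by positivity

theorem IsLevyMeasure.integrable_levyWeight {ν : Measure ℝ} (hν : IsLevyMeasure ν) :
    Integrable levyWeight ν := by
  refine ⟨continuous_levyWeight.aestronglyMeasurable, ?_⟩
  rw [hasFiniteIntegral_iff_ofReal (Eventually.of_forall levyWeight_nonneg)]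
  exact hν.2

section Jump

variable {E : Type*} [NormedAddCommGroup E] [NormedSpace ℝ E]

/-- The compensated increment `F (x + y) - F x - y F'(x) 1_{|y| ≤ 1}`. -/
def jump (F F' : ℝ → E) (x y : ℝ) : E :=
  F (x + y) - F x - (Icc (-1 : ℝ) 1).indicator (fun y => y • F' x) y

theorem norm_taylor_le {F F' F'' : ℝ → E} (h1 : ∀ x, HasDerivAt F (F' x) x)
    (h2 : ∀ x, HasDerivAt F' (F'' x) x) {M : ℝ} (hM : ∀ x, ‖F'' x‖ ≤ M) (x y : ℝ) :
    ‖F (x + y) - F x - y • F' x‖ ≤ M * y ^ 2 := by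
  have hM0 : 0 ≤ M := (norm_nonneg _).trans (hM 0)
  have hlip : ∀ s, ‖F' (x + s) - F' x‖ ≤ M * |s| := by
    intro s
    have := convex_univ.norm_image_sub_le_of_norm_hasDerivWithin_le
      (fun z _ => (h2 z).hasDerivWithinAt) (fun z _ => hM z) (mem_univ x) (mem_univ (x + s))
    simpa using this
  have hd : ∀ s, HasDerivAt (fun s => F (x + s) - s • F' x) (F' (x + s) - F' x) s := by
    intro s
    have ha : HasDerivAt (fun s => F (x + s)) (F' (x + s)) s := (h1 (x + s)).comp_const_add x s
    have hb : HasDerivAt (fun s : ℝ => s • F' x) ((1 : ℝ) • F' x) s :=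
      (hasDerivAt_id s).smul_const _
    rw [one_smul] at hb
    exact ha.sub hb
  have := (convex_uIcc 0 y).norm_image_sub_le_of_norm_hasDerivWithin_le (C := M * |y|)
    (fun z _ => (hd z).hasDerivWithinAt)
    (fun z hz => (hlip z).trans (mul_le_mul_of_nonneg_left (by
      rcases le_total 0 y with hy | hy
      · rw [uIcc_of_le hy] at hz
        rw [abs_of_nonneg hz.1, abs_of_nonneg hy]; exact hz.2
      · rw [uIcc_of_ge hy] at hz
        rw [abs_of_nonpos hz.2, abs_of_nonpos hy]; linarith [hz.1]) hM0))
    left_mem_uIcc right_mem_uIcc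
  simp only [add_zero, zero_smul, sub_zero, Real.norm_eq_abs] at this
  rw [mul_assoc, abs_mul_abs_self, ← sq] at this
  convert this using 2
  abel

theorem norm_jump_le {F F' F'' : ℝ → E} (h1 : ∀ x, HasDerivAt F (F' x) x)
    (h2 : ∀ x, HasDerivAt F' (F'' x) x) {M : ℝ} (hM0 : ∀ x, ‖F x‖ ≤ M)
    (hM : ∀ x, ‖F'' x‖ ≤ M) (x y : ℝ) :
    ‖jump F F' x y‖ ≤ 4 * M * levyWeight y := by
  have hM' : 0 ≤ M := (norm_nonneg _).trans (hM 0)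
  unfold jump
  by_cases hy : y ∈ Icc (-1 : ℝ) 1
  · rw [indicator_of_mem hy]
    refine (norm_taylor_le h1 h2 hM x y).trans ?_
    nlinarith [sq_le_levyWeight hy, levyWeight_nonneg y,
      mul_le_mul_of_nonneg_left (sq_le_levyWeight hy) hM', mul_nonneg hM' (levyWeight_nonneg y)]
  · rw [indicator_of_notMem hy, sub_zero]
    have := norm_sub_le (F (x + y)) (F x)
    nlinarith [hM0 (x + y), hM0 x, mul_le_mul_of_nonneg_left (one_le_levyWeight hy) hM']

end Jump

/-! ### The Lévy exponent -/

/-- The function `exp (i y z) - 1 - i y z 1_{|y| ≤ 1}` whose `ν`-integral enters the exponent. -/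
def levyKernel (z y : ℝ) : ℂ :=
  Complex.exp (Complex.I * y * z) - 1
    - (Icc (-1 : ℝ) 1).indicator (fun x : ℝ => Complex.I * x * z) y

theorem hasDerivAt_exp_I_mul (z y : ℝ) :
    HasDerivAt (fun y : ℝ => Complex.exp (Complex.I * y * z))
      (Complex.I * z * Complex.exp (Complex.I * y * z)) y := by
  have h : HasDerivAt (fun y : ℝ => Complex.I * (y : ℂ) * z) (Complex.I * z) y := by
    have := ((hasDerivAt_id y).ofReal_comp.const_mul Complex.I).mul_const (z : ℂ)
    simpa using this
  convert h.cexp using 1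
  ring

theorem norm_exp_I_mul (y z : ℝ) : ‖Complex.exp (Complex.I * y * z)‖ = 1 := by
  have : Complex.I * y * z = ((y * z : ℝ) : ℂ) * Complex.I := by push_cast; ring
  rw [this, Complex.norm_exp_ofReal_mul_I]

/-- This turns the general bound on compensated increments into a bound on the exponent. -/
theorem levyKernel_eq_jump (z y : ℝ) :
    levyKernel z y = jump (fun y : ℝ => Complex.exp (Complex.I * y * z))
      (fun y : ℝ => Complex.I * z * Complex.exp (Complex.I * y * z)) 0 y := by
  unfold levyKernel jump
  congr 1
  · simp
  · congr 1
    ext x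
    simp
    ring

theorem norm_levyKernel_le (z y : ℝ) :
    ‖levyKernel z y‖ ≤ 4 * (1 + z ^ 2) * levyWeight y := by
  rw [levyKernel_eq_jump]
  refine norm_jump_le (F'' := fun y : ℝ => (Complex.I * z) *
    (Complex.I * z * Complex.exp (Complex.I * y * z))) (fun x => hasDerivAt_exp_I_mul z x)
    (fun x => (hasDerivAt_exp_I_mul z x).const_mul _) (fun x => ?_) (fun x => ?_) 0 y
  · rw [norm_exp_I_mul]; nlinarith [sq_nonneg z]
  · simp only [norm_mul, norm_exp_I_mul, Complex.norm_I, Complex.norm_real, Real.norm_eq_abs]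
    nlinarith [abs_mul_abs_self z]

theorem measurable_levyKernel : Measurable (fun p : ℝ × ℝ => levyKernel p.1 p.2) := by
  unfold levyKernel
  refine Measurable.sub (by fun_prop) ?_
  have : (fun p : ℝ × ℝ => (Icc (-1 : ℝ) 1).indicator
      (fun x : ℝ => Complex.I * x * (p.1 : ℂ)) p.2)
      = (Prod.snd ⁻¹' Icc (-1 : ℝ) 1).indicator
        (fun p : ℝ × ℝ => Complex.I * (p.2 : ℂ) * (p.1 : ℂ)) := by
    ext p
    by_cases h : p.2 ∈ Icc (-1 : ℝ) 1
    · rw [indicator_of_mem h, indicator_of_mem (show p ∈ Prod.snd ⁻¹' Icc (-1 : ℝ) 1 from h)]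
    · rw [indicator_of_notMem h,
        indicator_of_notMem (show p ∉ Prod.snd ⁻¹' Icc (-1 : ℝ) 1 from h)]
  rw [this]
  exact Measurable.indicator (by fun_prop) (measurable_snd measurableSet_Icc)

variable {A γ : ℝ} {ν : Measure ℝ}

theorem levyExponent_eq (z : ℝ) : levyExponent A γ ν z
    = (1 / 2 : ℂ) * A * z ^ 2 - Complex.I * γ * z - ∫ y, levyKernel z y ∂ν := rfl

theorem measurable_levyExponent [SFinite ν] : Measurable (levyExponent A γ ν) := by
  have h : StronglyMeasurable fun z => ∫ y, levyKernel z y ∂ν :=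
    measurable_levyKernel.stronglyMeasurable.integral_prod_right
  have : levyExponent A γ ν = fun z : ℝ =>
    (1 / 2 : ℂ) * A * z ^ 2 - Complex.I * γ * z - ∫ y, levyKernel z y ∂ν := rfl
  rw [this]
  exact Measurable.sub (by fun_prop) h.measurable

theorem exists_norm_levyExponent_le (hν : IsLevyMeasure ν) :
    ∃ c, 0 ≤ c ∧ ∀ z, ‖levyExponent A γ ν z‖ ≤ c * (1 + z ^ 2) := by
  refine ⟨|A| + |γ| + 4 * ∫ y, levyWeight y ∂ν, ?_, fun z => ?_⟩
  · have := integral_nonneg (μ := ν) (f := levyWeight) levyWeight_nonneg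
    positivity
  have h1 : ‖∫ y, levyKernel z y ∂ν‖ ≤ ∫ y, 4 * (1 + z ^ 2) * levyWeight y ∂ν :=
    norm_integral_le_of_norm_le (hν.integrable_levyWeight.const_mul _)
      (Eventually.of_forall (norm_levyKernel_le z))
  rw [integral_const_mul] at h1
  rw [levyExponent_eq]
  refine (norm_sub_le _ _).trans ?_
  have h2 := norm_sub_le ((1 / 2 : ℂ) * A * z ^ 2) (Complex.I * γ * z)
  have h3 : ‖(1 / 2 : ℂ) * A * z ^ 2‖ = 1 / 2 * |A| * z ^ 2 := by
    simp
  have h4 : ‖Complex.I * γ * z‖ = |γ| * |z| := by simp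
  have h5 : |z| ≤ 1 + z ^ 2 := by nlinarith [abs_mul_abs_self z, sq_nonneg (|z| - 1)]
  nlinarith [abs_nonneg A, abs_nonneg γ, sq_nonneg z, mul_nonneg (abs_nonneg A) (sq_nonneg z),
    mul_le_mul_of_nonneg_left h5 (abs_nonneg γ)]

theorem norm_exp_neg_mul_sub_one_le {w : ℂ} (hw : 0 ≤ w.re) {t : ℝ} (ht : 0 ≤ t) :
    ‖Complex.exp (-t * w) - 1‖ ≤ t * ‖w‖ := by
  have hd : ∀ s : ℝ, HasDerivAt (fun s : ℝ => Complex.exp (-s * w))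
      (-w * Complex.exp (-s * w)) s := by
    intro s
    have h : HasDerivAt (fun s : ℝ => -(s : ℂ) * w) (-w) s := by
      have := ((hasDerivAt_id s).ofReal_comp.neg).mul_const w
      simpa using this
    convert h.cexp using 1
    ring
  have := (convex_Icc 0 t).norm_image_sub_le_of_norm_hasDerivWithin_le (C := ‖w‖)
    (fun z _ => (hd z).hasDerivWithinAt) (fun s hs => ?_) (left_mem_Icc.2 ht)
    (right_mem_Icc.2 ht)
  · simpa [abs_of_nonneg ht, mul_comm] using this
  · rw [norm_mul, norm_neg, Complex.norm_exp]
    have : (-(s : ℂ) * w).re ≤ 0 := by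
      simp
      exact mul_nonneg hs.1 hw
    exact mul_le_of_le_one_right (norm_nonneg _) (Real.exp_le_one_iff.2 this)

/-- `μ` is the family of one-dimensional laws of a Lévy process with triplet `(A, γ, ν)`. -/
structure IsLevyFamily (μ : ℝ≥0 → Measure ℝ) (A γ : ℝ) (ν : Measure ℝ) : Prop where
  prob : ∀ t, IsProbabilityMeasure (μ t)
  levyMeasure : IsLevyMeasure ν
  charFun_eq : ∀ (t : ℝ≥0) (z : ℝ),
    ∫ y, Complex.exp (Complex.I * z * y) ∂(μ t) = Complex.exp (-t * levyExponent A γ ν z)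

variable {μ : ℝ≥0 → Measure ℝ}

/-- Characteristic functions are bounded by `1`, so `exp (-λ)` is. -/
theorem IsLevyFamily.re_nonneg (hμ : IsLevyFamily μ A γ ν) (z : ℝ) :
    0 ≤ (levyExponent A γ ν z).re := by
  have := hμ.prob 1
  have h : ‖∫ y, Complex.exp (Complex.I * z * y) ∂(μ 1)‖ ≤ 1 := by
    refine (norm_integral_le_integral_norm _).trans ?_
    simp [norm_exp_I_mul]
  rw [hμ.charFun_eq, Complex.norm_exp, Real.exp_le_one_iff] at h
  simpa using h

/-! ### Fourier integrals -/

/-- `g` is the Fourier integral `∫ exp (i ξ x) h(ξ) dξ` of a density with `(1 + ξ²) h(ξ)`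
integrable. -/
structure IsFourierIntegral (g : ℝ → ℝ) (h : ℝ → ℂ) : Prop where
  contDiff : ContDiff ℝ 2 g
  integrable : Integrable h
  integrable_sq : Integrable fun ξ : ℝ => (ξ : ℂ) ^ 2 * h ξ
  eq : ∀ x, (g x : ℂ) = ∫ ξ : ℝ, Complex.exp (Complex.I * ξ * x) * h ξ

variable {g : ℝ → ℝ} {h : ℝ → ℂ}

theorem IsFourierIntegral.integrable_weight (hg : IsFourierIntegral g h) :
    Integrable fun ξ : ℝ => (1 + ξ ^ 2) * ‖h ξ‖ := by
  have h1 := hg.integrable.norm.add hg.integrable_sq.norm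
  refine h1.congr (Eventually.of_forall fun ξ => ?_)
  simp
  ring

theorem IsFourierIntegral.integrable_id (hg : IsFourierIntegral g h) :
    Integrable fun ξ : ℝ => (ξ : ℂ) * h ξ := by
  refine hg.integrable_weight.mono' (by
    exact Complex.continuous_ofReal.aestronglyMeasurable.mul hg.integrable.aestronglyMeasurable) ?_
  refine Eventually.of_forall fun ξ => ?_
  rw [norm_mul, Complex.norm_real, Real.norm_eq_abs]
  refine mul_le_mul_of_nonneg_right ?_ (norm_nonneg _)
  nlinarith [abs_mul_abs_self ξ, sq_nonneg (|ξ| - 1)]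

theorem integrable_exp_mul {h : ℝ → ℂ} (hh : Integrable h) (x : ℝ) :
    Integrable fun ξ : ℝ => Complex.exp (Complex.I * ξ * x) * h ξ := by
  refine hh.norm.mono' ((by fun_prop : Continuous fun ξ : ℝ =>
    Complex.exp (Complex.I * ξ * x)).aestronglyMeasurable.mul hh.aestronglyMeasurable) ?_
  exact Eventually.of_forall fun ξ => by rw [norm_mul, norm_exp_I_mul, one_mul]

theorem hasDerivAt_fourierIntegral {h : ℝ → ℂ} (hh : Integrable h)
    (hh1 : Integrable fun ξ : ℝ => (ξ : ℂ) * h ξ) (x : ℝ) :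
    HasDerivAt (fun x : ℝ => ∫ ξ : ℝ, Complex.exp (Complex.I * ξ * x) * h ξ)
      (∫ ξ : ℝ, Complex.exp (Complex.I * ξ * x) * (Complex.I * ξ * h ξ)) x := by
  have hI : Integrable fun ξ : ℝ => Complex.I * ξ * h ξ := by
    simpa [mul_assoc] using hh1.const_mul Complex.I
  refine (hasDerivAt_integral_of_dominated_loc_of_deriv_le
    (F' := fun (x ξ : ℝ) => Complex.exp (Complex.I * ξ * x) * (Complex.I * ξ * h ξ))
    (bound := fun ξ => ‖Complex.I * ξ * h ξ‖) (s := univ) univ_mem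
    (Eventually.of_forall fun x => (integrable_exp_mul hh x).aestronglyMeasurable)
    (integrable_exp_mul hh x) (integrable_exp_mul hI x).aestronglyMeasurable
    (Eventually.of_forall fun ξ x _ => ?_) hI.norm (Eventually.of_forall fun ξ x _ => ?_)).2
  · rw [norm_mul, norm_exp_I_mul, one_mul]
  · have h1 := (hasDerivAt_exp_I_mul ξ x).mul_const (h ξ)
    have e : ∀ x : ℝ, Complex.I * ξ * x = Complex.I * x * ξ := fun x => by ring
    refine (h1.congr_of_eventuallyEq (Eventually.of_forall fun x => ?_)).congr_deriv ?_
    · simp only [e]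
    · rw [e]
      ring

theorem IsFourierIntegral.deriv_eq (hg : IsFourierIntegral g h) (x : ℝ) :
    ((deriv g x : ℝ) : ℂ) = ∫ ξ : ℝ, Complex.exp (Complex.I * ξ * x) * (Complex.I * ξ * h ξ) := by
  have h1 := ((hg.contDiff.differentiable (by norm_num)) x).hasDerivAt.ofReal_comp
  have h2 := hasDerivAt_fourierIntegral hg.integrable hg.integrable_id x
  simp only [hg.eq] at h1
  exact h1.unique h2

theorem IsFourierIntegral.deriv_deriv_eq (hg : IsFourierIntegral g h) (x : ℝ) :
    ((deriv (deriv g) x : ℝ) : ℂ)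
      = ∫ ξ : ℝ, Complex.exp (Complex.I * ξ * x) * (-(ξ : ℂ) ^ 2 * h ξ) := by
  have hd : ContDiff ℝ 1 (deriv g) := by
    have : ContDiff ℝ (1 + 1) g := by simpa [one_add_one_eq_two] using hg.contDiff
    exact (contDiff_succ_iff_deriv.1 this).2.2
  have h1 := ((hd.differentiable (by norm_num)) x).hasDerivAt.ofReal_comp
  have h2 := hasDerivAt_fourierIntegral (h := fun ξ : ℝ => Complex.I * ξ * h ξ)
    (by simpa [mul_assoc] using hg.integrable_id.const_mul Complex.I)
    ((hg.integrable_sq.const_mul Complex.I).congr (Eventually.of_forall fun ξ => by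
      ring)) x
  simp only [hg.deriv_eq] at h1
  rw [h1.unique h2]
  refine integral_congr_ae (Eventually.of_forall fun ξ => ?_)
  dsimp only
  linear_combination (Complex.exp (Complex.I * ξ * x) * (ξ : ℂ) ^ 2 * h ξ) * Complex.I_sq

/-- The action of the semigroup on a Fourier integral is multiplication by `exp (-t λ)`. -/
theorem IsFourierIntegral.integral_translate (hg : IsFourierIntegral g h)
    (hμ : IsLevyFamily μ A γ ν) (t : ℝ≥0) (x : ℝ) :
    ((∫ y, g (x + y) ∂(μ t) : ℝ) : ℂ) = ∫ ξ : ℝ, Complex.exp (Complex.I * ξ * x) *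
      (Complex.exp (-t * levyExponent A γ ν ξ) * h ξ) := by
  have := hμ.prob t
  have hc : Continuous fun p : ℝ × ℝ => Complex.exp (Complex.I * p.2 * (x + p.1 : ℝ)) := by
    fun_prop
  rw [← integral_complex_ofReal]
  simp only [hg.eq]
  rw [integral_integral_swap]
  · refine integral_congr_ae (Eventually.of_forall fun ξ => ?_)
    dsimp only
    rw [← hμ.charFun_eq, ← mul_assoc, ← integral_const_mul, ← integral_mul_const]
    refine integral_congr_ae (Eventually.of_forall fun y => ?_)
    dsimp only
    have : Complex.exp (Complex.I * ξ * (x + y : ℝ))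
      = Complex.exp (Complex.I * ξ * x) * Complex.exp (Complex.I * ξ * y) := by
      rw [← Complex.exp_add]; push_cast; ring_nf
    rw [this]
  · have h1 : Integrable (fun p : ℝ × ℝ => (1 : ℝ) * ‖h p.2‖) ((μ t).prod volume) :=
      (integrable_const (1 : ℝ)).mul_prod hg.integrable.norm
    refine h1.mono' ?_ ?_
    · exact hc.aestronglyMeasurable.mul hg.integrable.aestronglyMeasurable.comp_snd
    · refine Eventually.of_forall fun p => ?_
      simp only [Function.uncurry, norm_mul, norm_exp_I_mul, one_mul, le_refl]

/-! ### The integro-differential operator -/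

/-- `A f'' / 2 + γ f' + ∫ (f(x + y) - f(x) - y f'(x) 1_{|y| ≤ 1}) dν(y)`. -/
def levyOp (A γ : ℝ) (ν : Measure ℝ) (f : ℝ → ℝ) (x : ℝ) : ℝ :=
  1 / 2 * A * deriv (deriv f) x + γ * deriv f x + ∫ y, jump f (deriv f) x y ∂ν

theorem IsFourierIntegral.jump_eq (hg : IsFourierIntegral g h) (x y : ℝ) :
    ((jump g (deriv g) x y : ℝ) : ℂ)
      = ∫ ξ : ℝ, Complex.exp (Complex.I * ξ * x) * (levyKernel ξ y * h ξ) := by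
  have hI : Integrable fun ξ : ℝ => Complex.I * ξ * h ξ := by
    simpa [mul_assoc] using hg.integrable_id.const_mul Complex.I
  have e1 : ((jump g (deriv g) x y : ℝ) : ℂ) = (g (x + y) : ℂ) - g x -
      (Icc (-1 : ℝ) 1).indicator (fun y : ℝ => (y : ℂ) * (deriv g x : ℝ)) y := by
    unfold jump
    by_cases hy : y ∈ Icc (-1 : ℝ) 1
    · simp [indicator_of_mem hy]
    · simp [indicator_of_notMem hy]
  rw [e1]
  have i1 := integrable_exp_mul hg.integrable (x + y)
  have i2 := integrable_exp_mul hg.integrable x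
  have i3 := (integrable_exp_mul hI x).const_mul (y : ℂ)
  have i12 : Integrable fun ξ : ℝ => Complex.exp (Complex.I * ξ * (x + y : ℝ)) * h ξ
      - Complex.exp (Complex.I * ξ * x) * h ξ := i1.sub i2
  by_cases hy : y ∈ Icc (-1 : ℝ) 1
  · rw [indicator_of_mem hy, hg.eq, hg.eq, hg.deriv_eq, ← integral_const_mul,
      ← integral_sub i1 i2, ← integral_sub i12 i3]
    refine integral_congr_ae (Eventually.of_forall fun ξ => ?_)
    simp only [levyKernel, indicator_of_mem hy]
    have : Complex.exp (Complex.I * ξ * (x + y : ℝ))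
      = Complex.exp (Complex.I * ξ * x) * Complex.exp (Complex.I * y * ξ) := by
      rw [← Complex.exp_add]; push_cast; ring_nf
    rw [this]
    ring
  · rw [indicator_of_notMem hy, hg.eq, hg.eq, sub_zero, ← integral_sub i1 i2]
    refine integral_congr_ae (Eventually.of_forall fun ξ => ?_)
    simp only [levyKernel, indicator_of_notMem hy]
    have : Complex.exp (Complex.I * ξ * (x + y : ℝ))
      = Complex.exp (Complex.I * ξ * x) * Complex.exp (Complex.I * y * ξ) := by
      rw [← Complex.exp_add]; push_cast; ring_nf
    rw [this]
    ring

/-- On Fourier integrals the integro-differential operator is multiplication by `-λ`. -/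
theorem IsFourierIntegral.levyOp_eq [SFinite ν] (hg : IsFourierIntegral g h)
    (hν : IsLevyMeasure ν) (x : ℝ) :
    ((levyOp A γ ν g x : ℝ) : ℂ)
      = ∫ ξ : ℝ, Complex.exp (Complex.I * ξ * x) * (-levyExponent A γ ν ξ * h ξ) := by
  have hbound : Integrable (fun p : ℝ × ℝ => (4 * levyWeight p.1) * ((1 + p.2 ^ 2) * ‖h p.2‖))
      (ν.prod volume) := (hν.integrable_levyWeight.const_mul 4).mul_prod hg.integrable_weight
  have hF : Integrable (Function.uncurry fun (y ξ : ℝ) =>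
      Complex.exp (Complex.I * ξ * x) * (levyKernel ξ y * h ξ)) (ν.prod volume) := by
    refine hbound.mono' ?_ (Eventually.of_forall fun p => ?_)
    · have hc : Continuous fun p : ℝ × ℝ => Complex.exp (Complex.I * p.2 * x) := by fun_prop
      exact hc.aestronglyMeasurable.mul
        ((measurable_levyKernel.comp measurable_swap).aestronglyMeasurable.mul
          hg.integrable.aestronglyMeasurable.comp_snd)
    · simp only [Function.uncurry, norm_mul, norm_exp_I_mul, one_mul]
      have := mul_le_mul_of_nonneg_right (norm_levyKernel_le p.2 p.1) (norm_nonneg (h p.2))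
      linarith
  have e : ((∫ y, jump g (deriv g) x y ∂ν : ℝ) : ℂ) = ∫ ξ : ℝ,
      Complex.exp (Complex.I * ξ * x) * ((∫ y, levyKernel ξ y ∂ν) * h ξ) := by
    rw [← integral_complex_ofReal]
    simp only [hg.jump_eq]
    rw [integral_integral_swap hF]
    refine integral_congr_ae (Eventually.of_forall fun ξ => ?_)
    dsimp only
    rw [integral_const_mul, integral_mul_const]
  have i3 : Integrable fun ξ : ℝ =>
      Complex.exp (Complex.I * ξ * x) * ((∫ y, levyKernel ξ y ∂ν) * h ξ) := by
    have := hF.integral_prod_right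
    refine this.congr (Eventually.of_forall fun ξ => ?_)
    simp only [Function.uncurry]
    rw [integral_const_mul, integral_mul_const]
  have hI : Integrable fun ξ : ℝ => Complex.I * ξ * h ξ := by
    simpa [mul_assoc] using hg.integrable_id.const_mul Complex.I
  have hI2 : Integrable fun ξ : ℝ => -(ξ : ℂ) ^ 2 * h ξ := by
    simpa [neg_mul] using hg.integrable_sq.neg
  have i1 := (integrable_exp_mul hI2 x).const_mul (1 / 2 * A : ℂ)
  have i2 := (integrable_exp_mul hI x).const_mul (γ : ℂ)
  have i12 : Integrable fun ξ : ℝ =>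
      (1 / 2 * A : ℂ) * (Complex.exp (Complex.I * ξ * x) * (-(ξ : ℂ) ^ 2 * h ξ))
        + (γ : ℂ) * (Complex.exp (Complex.I * ξ * x) * (Complex.I * ξ * h ξ)) := i1.add i2
  unfold levyOp
  push_cast
  rw [e, hg.deriv_eq, hg.deriv_deriv_eq, ← integral_const_mul, ← integral_const_mul,
    ← integral_add i1 i2, ← integral_add i12 i3]
  refine integral_congr_ae (Eventually.of_forall fun ξ => ?_)
  simp only [levyExponent_eq]
  ring

theorem IsLevyFamily.integrable_exponent_mul [SFinite ν] (hμ : IsLevyFamily μ A γ ν)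
    (hg : IsFourierIntegral g h) : Integrable fun ξ => ‖levyExponent A γ ν ξ‖ * ‖h ξ‖ := by
  obtain ⟨c, -, hc⟩ := exists_norm_levyExponent_le (A := A) (γ := γ) hμ.levyMeasure
  refine (hg.integrable_weight.const_mul c).mono'
    (measurable_levyExponent.norm.aestronglyMeasurable.mul
      hg.integrable.norm.aestronglyMeasurable) (Eventually.of_forall fun ξ => ?_)
  rw [norm_mul, norm_norm, norm_norm, ← mul_assoc]
  exact mul_le_mul_of_nonneg_right (hc ξ) (norm_nonneg _)

theorem IsLevyFamily.integrable_exp_mul [SFinite ν] (hμ : IsLevyFamily μ A γ ν)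
    (hg : IsFourierIntegral g h) (t : ℝ≥0) :
    Integrable fun ξ => Complex.exp (-t * levyExponent A γ ν ξ) * h ξ := by
  refine hg.integrable.norm.mono' ?_ (Eventually.of_forall fun ξ => ?_)
  · have hm := measurable_levyExponent (A := A) (γ := γ) (ν := ν)
    exact (by fun_prop : Measurable fun ξ =>
      Complex.exp (-t * levyExponent A γ ν ξ)).aestronglyMeasurable.mul
      hg.integrable.aestronglyMeasurable
  · rw [norm_mul, Complex.norm_exp]
    refine mul_le_of_le_one_left (norm_nonneg _) (Real.exp_le_one_iff.2 ?_)
    have := mul_nonneg t.2 (hμ.re_nonneg ξ)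
    simpa using this

/-- The increments of the semigroup on a Fourier integral are `O(t)` at every point. -/
theorem IsFourierIntegral.exists_abs_integral_sub_le [SFinite ν] (hg : IsFourierIntegral g h)
    (hμ : IsLevyFamily μ A γ ν) :
    ∃ c, ∀ (t : ℝ≥0) x, |∫ y, g (x + y) ∂(μ t) - g x| ≤ c * t := by
  refine ⟨∫ ξ, ‖levyExponent A γ ν ξ‖ * ‖h ξ‖, fun t x => ?_⟩
  rw [← Real.norm_eq_abs, ← Complex.norm_real]
  push_cast
  rw [hg.integral_translate hμ, hg.eq, ← integral_sub
    (LevyConv.integrable_exp_mul (hμ.integrable_exp_mul hg t) x)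
    (LevyConv.integrable_exp_mul hg.integrable x), ← integral_mul_const]
  refine norm_integral_le_of_norm_le ((hμ.integrable_exponent_mul hg).mul_const _)
    (Eventually.of_forall fun ξ => ?_)
  rw [← mul_sub, norm_mul, norm_exp_I_mul, one_mul, ← sub_one_mul, norm_mul]
  have := norm_exp_neg_mul_sub_one_le (hμ.re_nonneg ξ) t.coe_nonneg
  have := mul_le_mul_of_nonneg_right this (norm_nonneg (h ξ))
  calc _ ≤ _ := this
    _ = _ := by ring

/-- On Fourier integrals the difference quotients of the semigroup converge uniformly. -/
theorem IsFourierIntegral.eventually_abs_quotient_sub_le [SFinite ν] (hg : IsFourierIntegral g h)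
    (hμ : IsLevyFamily μ A γ ν) {ε : ℝ} (hε : 0 < ε) :
    ∀ᶠ t : ℝ≥0 in 𝓝[>] 0, ∀ x,
      |(t : ℝ)⁻¹ * (∫ y, g (x + y) ∂(μ t) - g x) - levyOp A γ ν g x| ≤ ε := by
  -- `q t` is the Fourier multiplier of the difference quotient minus its limit.
  let q : ℝ≥0 → ℝ → ℂ := fun t ξ =>
    (t : ℂ)⁻¹ * (Complex.exp (-t * levyExponent A γ ν ξ) - 1) + levyExponent A γ ν ξ
  have hm := measurable_levyExponent (A := A) (γ := γ) (ν := ν)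
  have hqm : ∀ t, Measurable (q t) := fun t => by
    have : Measurable fun ξ => (t : ℂ)⁻¹ * (Complex.exp (-t * levyExponent A γ ν ξ) - 1)
      + levyExponent A γ ν ξ := by fun_prop
    exact this
  have hqb : ∀ᶠ t : ℝ≥0 in 𝓝[>] 0, ∀ ξ, ‖q t ξ‖ ≤ 2 * ‖levyExponent A γ ν ξ‖ := by
    filter_upwards [self_mem_nhdsWithin] with t ht ξ
    have ht' : (0 : ℝ) < t := ht
    refine (norm_add_le _ _).trans ?_
    have h1 := norm_exp_neg_mul_sub_one_le (hμ.re_nonneg ξ) t.coe_nonneg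
    have h2 : ‖(t : ℂ)⁻¹ * (Complex.exp (-t * levyExponent A γ ν ξ) - 1)‖
        ≤ ‖levyExponent A γ ν ξ‖ := by
      rw [norm_mul, norm_inv]
      rw [Complex.norm_real, Real.norm_of_nonneg t.coe_nonneg, inv_mul_le_iff₀ ht']
      exact h1
    linarith
  have hql : ∀ ξ, Tendsto (fun t => q t ξ) (𝓝[>] 0) (𝓝 0) := by
    intro ξ
    set w := levyExponent A γ ν ξ
    have hd : HasDerivAt (fun s : ℝ => Complex.exp (-s * w)) (-w) 0 := by
      have h : HasDerivAt (fun s : ℝ => -(s : ℂ) * w) (-w) 0 := by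
        have := ((hasDerivAt_id (0 : ℝ)).ofReal_comp.neg).mul_const w
        simpa using this
      simpa using h.cexp
    have h1 := hd.tendsto_slope_zero_right
    have h2 : Tendsto (fun t : ℝ≥0 => (t : ℝ)) (𝓝[>] 0) (𝓝[>] 0) := by
      refine tendsto_nhdsWithin_iff.2 ⟨?_, ?_⟩
      · exact (NNReal.continuous_coe.tendsto' 0 0 rfl).mono_left nhdsWithin_le_nhds
      · filter_upwards [self_mem_nhdsWithin] with t ht
        exact ht
    have h3 := (h1.comp h2).add_const w
    simp only [neg_add_cancel] at h3
    refine h3.congr fun t => ?_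
    simp [q, w]
  have hlim : Tendsto (fun t => ∫ ξ, ‖q t ξ‖ * ‖h ξ‖) (𝓝[>] 0) (𝓝 (∫ ξ : ℝ, (0 : ℝ))) := by
    refine tendsto_integral_filter_of_dominated_convergence
      (fun ξ => 2 * (‖levyExponent A γ ν ξ‖ * ‖h ξ‖)) ?_ ?_
      ((hμ.integrable_exponent_mul hg).const_mul 2) ?_
    · exact Eventually.of_forall fun t => (hqm t).norm.aestronglyMeasurable.mul
        hg.integrable.norm.aestronglyMeasurable
    · filter_upwards [hqb] with t ht
      refine Eventually.of_forall fun ξ => ?_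
      rw [norm_mul, norm_norm, norm_norm, ← mul_assoc]
      exact mul_le_mul_of_nonneg_right (ht ξ) (norm_nonneg _)
    · refine Eventually.of_forall fun ξ => ?_
      have := ((hql ξ).norm).mul_const ‖h ξ‖
      simpa using this
  rw [integral_zero] at hlim
  filter_upwards [hlim.eventually_le_const hε, hqb] with t ht htb x
  refine le_trans ?_ ht
  rw [← Real.norm_eq_abs, ← Complex.norm_real]
  have iexp : Integrable fun ξ => -levyExponent A γ ν ξ * h ξ := by
    refine (hμ.integrable_exponent_mul hg).mono' (hm.neg.aestronglyMeasurable.mul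
      hg.integrable.aestronglyMeasurable) (Eventually.of_forall fun ξ => ?_)
    rw [norm_mul, norm_neg]
  have i1 := LevyConv.integrable_exp_mul (hμ.integrable_exp_mul hg t) x
  have i2 := LevyConv.integrable_exp_mul hg.integrable x
  have i3 := LevyConv.integrable_exp_mul iexp x
  have i12 : Integrable fun ξ : ℝ => (t : ℂ)⁻¹ * (Complex.exp (Complex.I * ξ * x) *
      (Complex.exp (-t * levyExponent A γ ν ξ) * h ξ) - Complex.exp (Complex.I * ξ * x) * h ξ) :=
    (i1.sub i2).const_mul _
  have key : (((t : ℝ)⁻¹ * (∫ y, g (x + y) ∂(μ t) - g x) - levyOp A γ ν g x : ℝ) : ℂ)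
      = ∫ ξ : ℝ, Complex.exp (Complex.I * ξ * x) * (q t ξ * h ξ) := by
    push_cast
    rw [hg.integral_translate hμ, hg.eq, hg.levyOp_eq hμ.levyMeasure, ← integral_sub i1 i2,
      ← integral_const_mul, ← integral_sub i12 i3]
    refine integral_congr_ae (Eventually.of_forall fun ξ => ?_)
    simp only [q]
    ring
  rw [key]
  refine norm_integral_le_of_norm_le ?_ (Eventually.of_forall fun ξ => ?_)
  · refine ((hμ.integrable_exponent_mul hg).const_mul 2).mono'
      ((hqm t).norm.aestronglyMeasurable.mul hg.integrable.norm.aestronglyMeasurable)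
      (Eventually.of_forall fun ξ => ?_)
    rw [norm_mul, norm_norm, norm_norm, ← mul_assoc]
    exact mul_le_mul_of_nonneg_right (htb ξ) (norm_nonneg _)
  · rw [norm_mul, norm_exp_I_mul, one_mul, norm_mul]

end

/-! ### Fourier inversion -/

section

open scoped FourierTransform SchwartzMap ContDiff

/-- Fourier inversion for Schwartz functions; `a = (2 π)⁻¹` rescales the frequency, since Mathlib's
transform uses the character `exp (2 π i ξ x)`. -/
theorem exists_isFourierIntegral {g : ℝ → ℝ} (hc : HasCompactSupport g) (hs : ContDiff ℝ ∞ g) :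
    ∃ h, IsFourierIntegral g h := by
  have hc' : HasCompactSupport fun x => (g x : ℂ) := hc.comp_left Complex.ofReal_zero
  have hs' : ContDiff ℝ ∞ fun x => (g x : ℂ) := Complex.ofRealCLM.contDiff.comp hs
  let S : 𝓢(ℝ, ℂ) := hc'.toSchwartzMap hs'
  let a : ℝ := (2 * Real.pi)⁻¹
  have ha : 0 < a := by positivity
  have ha' : 2 * Real.pi * a = 1 := mul_inv_cancel₀ (by positivity)
  refine ⟨fun ξ => (a : ℂ) * 𝓕 S (a * ξ), contDiff_infty.1 hs 2, ?_, ?_, fun x => ?_⟩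
  · exact ((𝓕 S).integrable.comp_mul_left' ha.ne').const_mul _
  · have h1 : Integrable fun ξ : ℝ => (ξ : ℂ) ^ 2 * 𝓕 S ξ := by
      refine ((𝓕 S).integrable_pow_mul volume 2).mono' (by
        exact (Continuous.mul (by fun_prop) (𝓕 S).continuous).aestronglyMeasurable) ?_
      exact Eventually.of_forall fun ξ => by simp
    refine ((h1.comp_mul_left' ha.ne').const_mul ((a : ℂ)⁻¹)).congr
      (Eventually.of_forall fun ξ => ?_)
    have : (a : ℂ) ≠ 0 := by exact_mod_cast ha.ne'
    push_cast
    field_simp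
  · have h1 : S x = 𝓕⁻ (𝓕 S) x := by rw [FourierTransform.fourierInv_fourier_eq]
    have h2 : (g x : ℂ) = S x := rfl
    rw [h2, h1, SchwartzMap.fourierInv_coe, Real.fourierInv_eq']
    have h3 := Measure.integral_comp_mul_left (fun v : ℝ =>
      (a : ℂ) * (Complex.exp ((2 * Real.pi * (inner ℝ v x) : ℝ) * Complex.I) • 𝓕 S v)) a
    rw [integral_const_mul, integral_const_mul, abs_of_pos (inv_pos.2 ha)] at h3
    have h4 : (a⁻¹ : ℝ) • ((a : ℂ) * ∫ v : ℝ,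
        Complex.exp ((2 * Real.pi * (inner ℝ v x) : ℝ) * Complex.I) • 𝓕 S v)
        = ∫ v : ℝ, Complex.exp ((2 * Real.pi * (inner ℝ v x) : ℝ) * Complex.I) • 𝓕 S v := by
      rw [Complex.real_smul, ← mul_assoc, ← Complex.ofReal_mul, inv_mul_cancel₀ ha.ne']
      simp
    rw [h4] at h3
    rw [← h3, ← integral_const_mul]
    refine integral_congr_ae (Eventually.of_forall fun ξ => ?_)
    have e : ((2 * Real.pi * (inner ℝ (a * ξ) x) : ℝ) : ℂ) * Complex.I = Complex.I * ξ * x := by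
      have : 2 * Real.pi * (inner ℝ (a * ξ) x) = (2 * Real.pi * a) * (ξ * x) := by
        simp
        ring
      rw [this, ha']
      push_cast
      ring
    dsimp only
    rw [e, smul_eq_mul]
    ring

end

/-! ### Functions with bounded derivatives up to order two -/

section

open scoped ContDiff

/-- `f` is twice continuously differentiable, and `f`, `f'`, `f''` are bounded by `M`. -/
structure C2Bounded (f : ℝ → ℝ) (M : ℝ) : Prop where
  contDiff : ContDiff ℝ 2 f
  bound : ∀ x, |f x| ≤ M
  bound_deriv : ∀ x, |deriv f x| ≤ M
  bound_deriv2 : ∀ x, |deriv (deriv f) x| ≤ M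

section C2

variable {f g : ℝ → ℝ} {M N : ℝ}

theorem hasDerivAt_of_contDiff_two (hf : ContDiff ℝ 2 f) (x : ℝ) :
    HasDerivAt f (deriv f x) x :=
  ((hf.differentiable (by norm_num)) x).hasDerivAt

theorem contDiff_deriv_of_contDiff_two (hf : ContDiff ℝ 2 f) : ContDiff ℝ 1 (deriv f) := by
  have : ContDiff ℝ (1 + 1) f := by simpa [one_add_one_eq_two] using hf
  exact (contDiff_succ_iff_deriv.1 this).2.2

theorem hasDerivAt_deriv_of_contDiff_two (hf : ContDiff ℝ 2 f) (x : ℝ) :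
    HasDerivAt (deriv f) (deriv (deriv f) x) x :=
  (((contDiff_deriv_of_contDiff_two hf).differentiable (by norm_num)) x).hasDerivAt

theorem continuous_deriv_deriv_of_contDiff_two (hf : ContDiff ℝ 2 f) :
    Continuous (deriv (deriv f)) :=
  (contDiff_deriv_of_contDiff_two hf).continuous_deriv (by norm_num)

theorem C2Bounded.nonneg (hf : C2Bounded f M) : 0 ≤ M := (abs_nonneg _).trans (hf.bound 0)

theorem C2Bounded.of_hasDerivAt {f f' f'' : ℝ → ℝ} (h1 : ∀ x, HasDerivAt f (f' x) x)
    (h2 : ∀ x, HasDerivAt f' (f'' x) x) (hc : Continuous f'') (b0 : ∀ x, |f x| ≤ M)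
    (b1 : ∀ x, |f' x| ≤ M) (b2 : ∀ x, |f'' x| ≤ M) : C2Bounded f M := by
  have e1 : deriv f = f' := funext fun x => (h1 x).deriv
  have e2 : deriv f' = f'' := funext fun x => (h2 x).deriv
  refine ⟨?_, b0, by rwa [e1], by rwa [e1, e2]⟩
  have : ContDiff ℝ (1 + 1) f := contDiff_succ_iff_deriv.2
    ⟨fun x => (h1 x).differentiableAt, by simp, by
      rw [e1]
      exact contDiff_one_iff_deriv.2 ⟨fun x => (h2 x).differentiableAt, by rwa [e2]⟩⟩
  simpa [one_add_one_eq_two] using this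

theorem C2Bounded.add (hf : C2Bounded f M) (hg : C2Bounded g N) :
    C2Bounded (fun x => f x + g x) (M + N) :=
  .of_hasDerivAt
    (fun x => (hasDerivAt_of_contDiff_two hf.contDiff x).add
      (hasDerivAt_of_contDiff_two hg.contDiff x))
    (fun x => (hasDerivAt_deriv_of_contDiff_two hf.contDiff x).add
      (hasDerivAt_deriv_of_contDiff_two hg.contDiff x))
    ((continuous_deriv_deriv_of_contDiff_two hf.contDiff).add
      (continuous_deriv_deriv_of_contDiff_two hg.contDiff))
    (fun x => (abs_add_le _ _).trans (add_le_add (hf.bound x) (hg.bound x)))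
    (fun x => (abs_add_le _ _).trans (add_le_add (hf.bound_deriv x) (hg.bound_deriv x)))
    (fun x => (abs_add_le _ _).trans (add_le_add (hf.bound_deriv2 x) (hg.bound_deriv2 x)))

theorem C2Bounded.sub (hf : C2Bounded f M) (hg : C2Bounded g N) :
    C2Bounded (fun x => f x - g x) (M + N) :=
  .of_hasDerivAt
    (fun x => (hasDerivAt_of_contDiff_two hf.contDiff x).sub
      (hasDerivAt_of_contDiff_two hg.contDiff x))
    (fun x => (hasDerivAt_deriv_of_contDiff_two hf.contDiff x).sub
      (hasDerivAt_deriv_of_contDiff_two hg.contDiff x))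
    ((continuous_deriv_deriv_of_contDiff_two hf.contDiff).sub
      (continuous_deriv_deriv_of_contDiff_two hg.contDiff))
    (fun x => (abs_sub _ _).trans (add_le_add (hf.bound x) (hg.bound x)))
    (fun x => (abs_sub _ _).trans (add_le_add (hf.bound_deriv x) (hg.bound_deriv x)))
    (fun x => (abs_sub _ _).trans (add_le_add (hf.bound_deriv2 x) (hg.bound_deriv2 x)))

theorem exists_c2Bounded_of_tendsto (hf : IsC0n 2 f) : ∃ M, C2Bounded f M := by
  have key : ∀ j ≤ 2, ∃ M, ∀ x, |iteratedDeriv j f x| ≤ M := by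
    intro j hj
    have hc : Continuous (iteratedDeriv j f) := hf.1.continuous_iteratedDeriv j (by
      exact_mod_cast hj)
    let F : C₀(ℝ, ℝ) := ⟨⟨_, hc⟩, hf.2 j hj⟩
    obtain ⟨M, hM⟩ := F.isBounded_range.exists_norm_le
    exact ⟨M, fun x => hM _ ⟨x, rfl⟩⟩
  obtain ⟨M0, h0⟩ := key 0 (by norm_num)
  obtain ⟨M1, h1⟩ := key 1 (by norm_num)
  obtain ⟨M2, h2⟩ := key 2 (by norm_num)
  rw [iteratedDeriv_zero] at h0
  rw [iteratedDeriv_one] at h1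
  rw [iteratedDeriv_succ, iteratedDeriv_one] at h2
  exact ⟨max M0 (max M1 M2), hf.1, fun x => (h0 x).trans (le_max_left _ _),
    fun x => (h1 x).trans ((le_max_left _ _).trans (le_max_right _ _)),
    fun x => (h2 x).trans ((le_max_right _ _).trans (le_max_right _ _))⟩

theorem exists_c2Bounded_of_hasCompactSupport (hf : ContDiff ℝ 2 f) (hc : HasCompactSupport f) :
    ∃ M, C2Bounded f M := by
  obtain ⟨M0, h0⟩ := hc.exists_bound_of_continuous hf.continuous
  obtain ⟨M1, h1⟩ := hc.deriv.exists_bound_of_continuous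
    (contDiff_deriv_of_contDiff_two hf).continuous
  obtain ⟨M2, h2⟩ := hc.deriv.deriv.exists_bound_of_continuous
    (continuous_deriv_deriv_of_contDiff_two hf)
  exact ⟨max M0 (max M1 M2), hf, fun x => (h0 x).trans (le_max_left _ _),
    fun x => (h1 x).trans ((le_max_left _ _).trans (le_max_right _ _)),
    fun x => (h2 x).trans ((le_max_right _ _).trans (le_max_right _ _))⟩

/-! ### Approximation by smooth compactly supported functions -/

/-- Multiplication by the cutoff `χ(ρ x)` with small `ρ` changes `f` little in the `C²` norm: the
derivatives of the cutoff are `O(ρ)`, and `1 - χ(ρ x)` lives where `f`, `f'`, `f''` are small. -/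
theorem exists_hasCompactSupport_c2Bounded_sub (hf : IsC0n 2 f) {ε : ℝ} (hε : 0 < ε) :
    ∃ g, HasCompactSupport g ∧ ContDiff ℝ 2 g ∧ C2Bounded (fun x => f x - g x) ε := by
  obtain ⟨M, hM⟩ := exists_c2Bounded_of_tendsto hf
  let χ : ContDiffBump (0 : ℝ) := ⟨1, 2, one_pos, one_lt_two⟩
  have hχ : ContDiff ℝ 2 χ := χ.contDiff
  obtain ⟨B, hB⟩ := exists_c2Bounded_of_hasCompactSupport hχ χ.hasCompactSupport
  set δ := ε / 4 with hδ
  have hδ0 : 0 < δ := by positivity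
  have hev : ∀ᶠ x in cocompact ℝ, |f x| ≤ δ ∧ |deriv f x| ≤ δ ∧ |deriv (deriv f) x| ≤ δ := by
    have t0 := hf.2 0 (by norm_num)
    have t1 := hf.2 1 (by norm_num)
    have t2 := hf.2 2 (by norm_num)
    rw [iteratedDeriv_zero] at t0
    rw [iteratedDeriv_one] at t1
    rw [iteratedDeriv_succ, iteratedDeriv_one] at t2
    have s0 := t0.abs.eventually_le_const (u := δ) (by simpa using hδ0)
    have s1 := t1.abs.eventually_le_const (u := δ) (by simpa using hδ0)
    have s2 := t2.abs.eventually_le_const (u := δ) (by simpa using hδ0)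
    filter_upwards [s0, s1, s2] with x a b c using ⟨a, b, c⟩
  obtain ⟨R, hR⟩ : ∃ R, ∀ x, R < |x| →
      |f x| ≤ δ ∧ |deriv f x| ≤ δ ∧ |deriv (deriv f) x| ≤ δ := by
    rw [← Metric.cobounded_eq_cocompact, ← comap_norm_atTop, eventually_comap] at hev
    obtain ⟨R, hR⟩ := eventually_atTop.1 hev
    exact ⟨R, fun x hx => hR |x| hx.le x rfl⟩
  have hM0 := hM.nonneg
  have hB0 := hB.nonneg
  obtain ⟨ρ, hρ0, hρ1, hρR, hρM⟩ : ∃ ρ : ℝ, 0 < ρ ∧ ρ ≤ 1 ∧ ρ * R ≤ 1 ∧ ρ * (B * M) ≤ δ := by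
    refine ⟨min 1 (min (1 / (|R| + 1)) (δ / (B * M + 1))), by positivity, min_le_left _ _, ?_, ?_⟩
    · have h1 : min 1 (min (1 / (|R| + 1)) (δ / (B * M + 1))) ≤ 1 / (|R| + 1) :=
        (min_le_right _ _).trans (min_le_left _ _)
      calc _ ≤ min 1 (min (1 / (|R| + 1)) (δ / (B * M + 1))) * |R| :=
            mul_le_mul_of_nonneg_left (le_abs_self R) (by positivity)
        _ ≤ 1 / (|R| + 1) * |R| := mul_le_mul_of_nonneg_right h1 (abs_nonneg R)
        _ ≤ 1 := by
            rw [one_div, inv_mul_le_iff₀ (by positivity)]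
            linarith
    · have h1 : min 1 (min (1 / (|R| + 1)) (δ / (B * M + 1))) ≤ δ / (B * M + 1) :=
        (min_le_right _ _).trans (min_le_right _ _)
      calc _ ≤ δ / (B * M + 1) * (B * M) := mul_le_mul_of_nonneg_right h1 (by positivity)
        _ ≤ δ := by
            rw [div_mul_eq_mul_div, div_le_iff₀ (by positivity)]
            nlinarith
  have hone : ∀ x, ¬ R < |x| → χ (ρ * x) = 1 := by
    intro x hx
    refine χ.one_of_mem_closedBall ?_
    rw [mem_closedBall_zero_iff, norm_mul, Real.norm_of_nonneg hρ0.le, Real.norm_eq_abs]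
    exact (mul_le_mul_of_nonneg_left (not_lt.1 hx) hρ0.le).trans hρR
  have hsmall : ∀ (u : ℝ → ℝ), (∀ x, R < |x| → |u x| ≤ δ) → ∀ x, |(1 - χ (ρ * x)) * u x| ≤ δ := by
    intro u hu x
    by_cases hx : R < |x|
    · rw [abs_mul]
      have h1 : |1 - χ (ρ * x)| ≤ 1 := by
        rw [abs_of_nonneg (by linarith [χ.le_one (x := ρ * x)])]
        linarith [χ.nonneg (x := ρ * x)]
      calc _ ≤ 1 * δ := mul_le_mul h1 (hu x hx) (abs_nonneg _) zero_le_one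
        _ = δ := one_mul δ
    · rw [hone x hx]
      simpa using hδ0.le
  have dχ1 : ∀ x, HasDerivAt (fun x => χ (ρ * x)) (ρ * deriv χ (ρ * x)) x := by
    intro x
    have := (hasDerivAt_of_contDiff_two hχ (ρ * x)).comp x ((hasDerivAt_id x).const_mul ρ)
    simpa [mul_comm, Function.comp_def] using this
  have dχ2 : ∀ x, HasDerivAt (fun x => ρ * deriv χ (ρ * x))
      (ρ * (ρ * deriv (deriv χ) (ρ * x))) x := by
    intro x
    have := (hasDerivAt_deriv_of_contDiff_two hχ (ρ * x)).comp x ((hasDerivAt_id x).const_mul ρ)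
    have := this.const_mul ρ
    simpa [mul_comm, Function.comp_def] using this
  have d1 := hasDerivAt_of_contDiff_two hf.1
  have d2 := hasDerivAt_deriv_of_contDiff_two hf.1
  have c2 := continuous_deriv_deriv_of_contDiff_two hf.1
  have cχ2 := continuous_deriv_deriv_of_contDiff_two hχ
  have cχ1 := (contDiff_deriv_of_contDiff_two hχ).continuous
  have c1 := (contDiff_deriv_of_contDiff_two hf.1).continuous
  have c0 := hf.1.continuous
  have bprod : ∀ a b : ℝ, |a| ≤ B → |b| ≤ M → |ρ * a * b| ≤ δ := by
    intro a b ha hb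
    rw [abs_mul, abs_mul, abs_of_pos hρ0, mul_assoc]
    exact (mul_le_mul_of_nonneg_left (mul_le_mul ha hb (abs_nonneg _) hB0) hρ0.le).trans hρM
  refine ⟨fun x => χ (ρ * x) * f x, ?_, ?_, ?_⟩
  · refine HasCompactSupport.mul_right ?_
    exact χ.hasCompactSupport.comp_homeomorph (Homeomorph.mulLeft₀ ρ hρ0.ne')
  · exact (hχ.comp (contDiff_const.mul contDiff_id)).mul hf.1
  · refine .of_hasDerivAt (f' := fun x => (1 - χ (ρ * x)) * deriv f x - ρ * deriv χ (ρ * x) * f x)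
      (f'' := fun x => (1 - χ (ρ * x)) * deriv (deriv f) x - ρ * deriv χ (ρ * x) * deriv f x
        - (ρ * (ρ * deriv (deriv χ) (ρ * x)) * f x + ρ * deriv χ (ρ * x) * deriv f x))
      (fun x => ?_) (fun x => ?_) ?_ (fun x => ?_) (fun x => ?_) (fun x => ?_)
    · refine ((d1 x).sub ((dχ1 x).mul (d1 x))).congr_deriv ?_
      ring
    · refine ((((dχ1 x).const_sub 1).mul (d2 x)).sub ((dχ2 x).mul (d1 x))).congr_deriv ?_
      ring
    · have := χ.continuous
      fun_prop
    · have := hsmall f (fun x hx => (hR x hx).1) x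
      rw [sub_mul, one_mul] at this
      linarith
    · have h1 := hsmall _ (fun x hx => (hR x hx).2.1) x
      have h2 := bprod _ _ (hB.bound_deriv (ρ * x)) (hM.bound x)
      have := abs_sub ((1 - χ (ρ * x)) * deriv f x) (ρ * deriv χ (ρ * x) * f x)
      linarith
    · have h1 := hsmall _ (fun x hx => (hR x hx).2.2) x
      have h2 := bprod _ _ (hB.bound_deriv (ρ * x)) (hM.bound_deriv x)
      have h3 : |ρ * (ρ * deriv (deriv χ) (ρ * x)) * f x| ≤ δ := by
        refine bprod _ _ ?_ (hM.bound x)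
        rw [abs_mul, abs_of_pos hρ0]
        exact (mul_le_of_le_one_left (abs_nonneg _) hρ1).trans (hB.bound_deriv2 _)
      have e1 := abs_sub ((1 - χ (ρ * x)) * deriv (deriv f) x - ρ * deriv χ (ρ * x) * deriv f x)
        (ρ * (ρ * deriv (deriv χ) (ρ * x)) * f x + ρ * deriv χ (ρ * x) * deriv f x)
      have e2 := abs_sub ((1 - χ (ρ * x)) * deriv (deriv f) x) (ρ * deriv χ (ρ * x) * deriv f x)
      have e3 := abs_add_le (ρ * (ρ * deriv (deriv χ) (ρ * x)) * f x)
        (ρ * deriv χ (ρ * x) * deriv f x)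
      linarith

/-- Mollification commutes with differentiation, and moves a uniformly continuous function
little. -/
theorem exists_contDiff_c2Bounded_sub (hf : ContDiff ℝ 2 f) (hc : HasCompactSupport f) {ε : ℝ}
    (hε : 0 < ε) :
    ∃ g, HasCompactSupport g ∧ ContDiff ℝ ∞ g ∧ C2Bounded (fun x => f x - g x) ε := by
  have d1 := hasDerivAt_of_contDiff_two hf
  have d2 := hasDerivAt_deriv_of_contDiff_two hf
  have hf1 := contDiff_deriv_of_contDiff_two hf
  have c2 := continuous_deriv_deriv_of_contDiff_two hf
  obtain ⟨r0, p0, h0⟩ := Metric.uniformContinuous_iff.1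
    (hc.uniformContinuous_of_continuous hf.continuous) ε hε
  obtain ⟨r1, p1, h1⟩ := Metric.uniformContinuous_iff.1
    (hc.deriv.uniformContinuous_of_continuous hf1.continuous) ε hε
  obtain ⟨r2, p2, h2⟩ := Metric.uniformContinuous_iff.1
    (hc.deriv.deriv.uniformContinuous_of_continuous c2) ε hε
  set r := min r0 (min r1 r2) with hr
  have pr : 0 < r := by positivity
  let φ : ContDiffBump (0 : ℝ) := ⟨r / 2, r, by positivity, by linarith⟩
  have hφ : LocallyIntegrable (φ.normed volume) := φ.continuous_normed.locallyIntegrable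
  let L := ContinuousLinearMap.lsmul ℝ ℝ (E := ℝ)
  have D1 := hc.hasDerivAt_convolution_right L hφ (hf.of_le (by norm_num))
  have D2 := hc.deriv.hasDerivAt_convolution_right L hφ hf1
  have C2 := hc.deriv.deriv.continuous_convolution_right L hφ c2
  have approx : ∀ u : ℝ → ℝ, Continuous u →
      (∀ x y, dist x y < r → dist (u x) (u y) < ε) → ∀ x,
      |u x - convolution (φ.normed volume) u L volume x| ≤ ε := by
    intro u hu h x
    rw [← Real.dist_eq, dist_comm]
    exact φ.dist_normed_convolution_le hu.aestronglyMeasurable fun y hy => (h y x hy).le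
  refine ⟨convolution (φ.normed volume) f L volume, φ.hasCompactSupport_normed.convolution L hc,
    φ.hasCompactSupport_normed.contDiff_convolution_left L φ.contDiff_normed
      hf.continuous.locallyIntegrable, ?_⟩
  refine .of_hasDerivAt (fun x => (d1 x).sub (D1 x)) (fun x => (d2 x).sub (D2 x)) (c2.sub C2)
    (approx f hf.continuous fun x y h => h0 (h.trans_le (min_le_left _ _)))
    (approx _ hf1.continuous fun x y h =>
      h1 (h.trans_le ((min_le_right _ _).trans (min_le_left _ _))))
    (approx _ c2 fun x y h => h2 (h.trans_le ((min_le_right _ _).trans (min_le_right _ _))))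

theorem exists_smooth_c2Bounded_sub (hf : IsC0n 2 f) {ε : ℝ} (hε : 0 < ε) :
    ∃ g, HasCompactSupport g ∧ ContDiff ℝ ∞ g ∧ C2Bounded (fun x => f x - g x) ε := by
  obtain ⟨u, huc, hu, hfu⟩ := exists_hasCompactSupport_c2Bounded_sub hf (half_pos hε)
  obtain ⟨g, hgc, hg, hug⟩ := exists_contDiff_c2Bounded_sub hu huc (half_pos hε)
  refine ⟨g, hgc, hg, ?_⟩
  simpa using hfu.add hug

end C2

end

section

open scoped ContDiff

variable {A γ : ℝ} {ν : Measure ℝ} {μ : ℝ≥0 → Measure ℝ} {f g : ℝ → ℝ} {M N : ℝ}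

/-! ### Bounds in the `C²` norm -/

theorem C2Bounded.norm_jump_le (hf : C2Bounded f M) (x y : ℝ) :
    ‖jump f (deriv f) x y‖ ≤ 4 * M * levyWeight y :=
  LevyConv.norm_jump_le (hasDerivAt_of_contDiff_two hf.contDiff)
    (hasDerivAt_deriv_of_contDiff_two hf.contDiff) hf.bound hf.bound_deriv2 x y

theorem C2Bounded.integrable_jump (hf : C2Bounded f M) (hν : IsLevyMeasure ν) (x : ℝ) :
    Integrable (jump f (deriv f) x) ν := by
  refine (hν.integrable_levyWeight.const_mul (4 * M)).mono' ?_
    (Eventually.of_forall (hf.norm_jump_le x))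
  have hc := hf.contDiff.continuous
  refine Measurable.aestronglyMeasurable ?_
  unfold jump
  refine Measurable.sub (by fun_prop) (Measurable.indicator (by fun_prop) measurableSet_Icc)

theorem exists_abs_levyOp_le (A γ : ℝ) (hν : IsLevyMeasure ν) :
    ∃ c, 0 ≤ c ∧ ∀ f M, C2Bounded f M → ∀ x, |levyOp A γ ν f x| ≤ c * M := by
  have hw : 0 ≤ ∫ y, levyWeight y ∂ν := integral_nonneg levyWeight_nonneg
  refine ⟨|A| + |γ| + 4 * ∫ y, levyWeight y ∂ν, by positivity, fun f M hf x => ?_⟩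
  have h1 : ‖∫ y, jump f (deriv f) x y ∂ν‖ ≤ ∫ y, 4 * M * levyWeight y ∂ν :=
    norm_integral_le_of_norm_le (hν.integrable_levyWeight.const_mul _)
      (Eventually.of_forall (hf.norm_jump_le x))
  rw [integral_const_mul, Real.norm_eq_abs] at h1
  unfold levyOp
  have e1 := abs_add_three (1 / 2 * A * deriv (deriv f) x) (γ * deriv f x)
    (∫ y, jump f (deriv f) x y ∂ν)
  have e2 : |1 / 2 * A * deriv (deriv f) x| ≤ |A| * M := by
    rw [abs_mul, abs_mul]
    refine mul_le_mul ?_ (hf.bound_deriv2 x) (abs_nonneg _) (abs_nonneg _)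
    rw [abs_of_pos (by norm_num : (0 : ℝ) < 1 / 2)]
    linarith [abs_nonneg A]
  have e3 : |γ * deriv f x| ≤ |γ| * M := by
    rw [abs_mul]
    exact mul_le_mul_of_nonneg_left (hf.bound_deriv x) (abs_nonneg _)
  nlinarith

theorem C2Bounded.levyOp_sub (hf : C2Bounded f M) (hg : C2Bounded g N) (hν : IsLevyMeasure ν)
    (x : ℝ) :
    levyOp A γ ν (fun x => f x - g x) x = levyOp A γ ν f x - levyOp A γ ν g x := by
  have e1 : deriv (fun x => f x - g x) = fun x => deriv f x - deriv g x := funext fun x =>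
    ((hasDerivAt_of_contDiff_two hf.contDiff x).sub
      (hasDerivAt_of_contDiff_two hg.contDiff x)).deriv
  have e2 : deriv (fun x => deriv f x - deriv g x) x = deriv (deriv f) x - deriv (deriv g) x :=
    ((hasDerivAt_deriv_of_contDiff_two hf.contDiff x).sub
      (hasDerivAt_deriv_of_contDiff_two hg.contDiff x)).deriv
  have e3 : ∀ y, jump (fun x => f x - g x) (fun x => deriv f x - deriv g x) x y
      = jump f (deriv f) x y - jump g (deriv g) x y := by
    intro y
    unfold jump
    by_cases hy : y ∈ Icc (-1 : ℝ) 1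
    · simp only [indicator_of_mem hy, smul_eq_mul]
      ring
    · simp only [indicator_of_notMem hy]
      ring
  unfold levyOp
  rw [e1, e2]
  simp only [e3]
  rw [integral_sub (hf.integrable_jump hν x) (hg.integrable_jump hν x)]
  ring

theorem IsLevyFamily.integrable_of_bounded (hμ : IsLevyFamily μ A γ ν) (t : ℝ≥0) {u : ℝ → ℝ}
    (hu : Continuous u) (hb : ∀ x, |u x| ≤ M) : Integrable u (μ t) := by
  have := hμ.prob t
  exact Integrable.of_bound hu.aestronglyMeasurable M (Eventually.of_forall hb)

/-- The difference quotients of the semigroup are bounded by the `C²` norm, uniformly in time.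
With a smooth cutoff `χ` that equals `1` on `[-1, 1]`, the remainder
`f(x + y) - f(x) - f'(x) y χ(y)` is at most `3 M (1 - (1 - y²) χ(y))`, and both `(1 - y²) χ` and
`y χ` are Fourier integrals, for which the semigroup moves by `O(t)`. -/
theorem IsLevyFamily.exists_abs_integral_sub_le [SFinite ν] (hμ : IsLevyFamily μ A γ ν) :
    ∃ c, 0 ≤ c ∧ ∀ f M, C2Bounded f M → ∀ (t : ℝ≥0) x,
      |∫ y, f (x + y) ∂(μ t) - f x| ≤ c * M * t := by
  let χ : ContDiffBump (0 : ℝ) := ⟨1, 2, one_pos, one_lt_two⟩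
  have hχ : ContDiff ℝ ∞ χ := χ.contDiff
  have hχc := χ.continuous
  have hχ0 : χ 0 = 1 := χ.one_of_mem_closedBall (by simp [χ])
  let ψ : ℝ → ℝ := fun y => (1 - y ^ 2) * χ y
  let θ : ℝ → ℝ := fun y => y * χ y
  have hψc : HasCompactSupport ψ := χ.hasCompactSupport.mul_left
  have hθc : HasCompactSupport θ := χ.hasCompactSupport.mul_left
  have hψ : ContDiff ℝ ∞ ψ := (contDiff_const.sub (contDiff_id.pow 2)).mul hχ
  have hθ : ContDiff ℝ ∞ θ := contDiff_id.mul hχ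
  obtain ⟨h1, hψF⟩ := exists_isFourierIntegral hψc hψ
  obtain ⟨h2, hθF⟩ := exists_isFourierIntegral hθc hθ
  obtain ⟨c1, hc1⟩ := hψF.exists_abs_integral_sub_le hμ
  obtain ⟨c2, hc2⟩ := hθF.exists_abs_integral_sub_le hμ
  obtain ⟨Mψ, hMψ⟩ := hψc.exists_bound_of_continuous hψ.continuous
  obtain ⟨Mθ, hMθ⟩ := hθc.exists_bound_of_continuous hθ.continuous
  refine ⟨3 * |c1| + |c2|, by positivity, fun f M hf t x => ?_⟩
  have := hμ.prob t
  have hM := hf.nonneg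
  have ht := t.coe_nonneg
  have iψ : Integrable ψ (μ t) := hμ.integrable_of_bounded t hψ.continuous hMψ
  have iθ : Integrable θ (μ t) := hμ.integrable_of_bounded t hθ.continuous hMθ
  have ifx : Integrable (fun y => f (x + y)) (μ t) :=
    hμ.integrable_of_bounded t (hf.contDiff.continuous.comp (by fun_prop)) fun y => hf.bound _
  have bψ : ∫ y, (1 - ψ y) ∂(μ t) ≤ |c1| * t := by
    have h := hc1 t 0
    rw [show ψ 0 = 1 by simp [ψ, hχ0]] at h
    simp only [zero_add] at h
    rw [integral_sub (integrable_const _) iψ]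
    simp only [integral_const, probReal_univ, smul_eq_mul, mul_one]
    have := neg_abs_le (∫ y, ψ y ∂(μ t) - 1)
    have := mul_le_mul_of_nonneg_right (le_abs_self c1) ht
    linarith
  have bθ : |∫ y, θ y ∂(μ t)| ≤ |c2| * t := by
    have h := hc2 t 0
    rw [show θ 0 = 0 by simp [θ]] at h
    simp only [zero_add, sub_zero] at h
    exact h.trans (mul_le_mul_of_nonneg_right (le_abs_self c2) ht)
  have rem : ∀ y, ‖f (x + y) - f x - deriv f x * θ y‖ ≤ 3 * M * (1 - ψ y) := by
    intro y
    -- For `|y| ≤ 1` the cutoff is `1`, and `1 - ψ y = y²`; for `|y| > 1`, `1 - ψ y ≥ 1`.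
    by_cases hy : |y| ≤ 1
    · have h1 : χ y = 1 := χ.one_of_mem_closedBall (by simpa [χ] using hy)
      have h := norm_taylor_le (hasDerivAt_of_contDiff_two hf.contDiff)
        (hasDerivAt_deriv_of_contDiff_two hf.contDiff) hf.bound_deriv2 x y
      simp only [θ, ψ, h1, mul_one]
      rw [smul_eq_mul, mul_comm y] at h
      refine h.trans ?_
      nlinarith [mul_nonneg hM (sq_nonneg y)]
    · push Not at hy
      have hy2 : |y| ≤ y ^ 2 := by nlinarith [abs_mul_abs_self y]
      have h0 := χ.nonneg (x := y)
      have h1 := χ.le_one (x := y)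
      have hw : 1 ≤ 1 - ψ y := by
        simp only [ψ]
        nlinarith [mul_nonneg h0 (by linarith : 0 ≤ y ^ 2 - 1)]
      have hθw : |θ y| ≤ 1 - ψ y := by
        simp only [ψ, θ]
        rw [abs_mul, abs_of_nonneg h0]
        nlinarith [mul_le_mul_of_nonneg_right hy2 h0]
      have e1 := norm_sub_le (f (x + y) - f x) (deriv f x * θ y)
      have e2 := norm_sub_le (f (x + y)) (f x)
      have e3 : ‖deriv f x * θ y‖ ≤ M * (1 - ψ y) := by
        rw [norm_mul]
        exact mul_le_mul (hf.bound_deriv x) hθw (norm_nonneg _) hM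
      have e4 := hf.bound (x + y)
      have e5 := hf.bound x
      simp only [Real.norm_eq_abs] at *
      nlinarith [mul_le_mul_of_nonneg_left hw hM]
  have split : ∫ y, f (x + y) ∂(μ t) - f x
      = ∫ y, (f (x + y) - f x - deriv f x * θ y) ∂(μ t) + deriv f x * ∫ y, θ y ∂(μ t) := by
    have i1 : Integrable (fun y => f (x + y) - f x) (μ t) := ifx.sub (integrable_const _)
    rw [integral_sub i1 (iθ.const_mul _),
      integral_sub ifx (integrable_const _), integral_const_mul]
    simp
  have b1 : ‖∫ y, (f (x + y) - f x - deriv f x * θ y) ∂(μ t)‖ ≤ ∫ y, 3 * M * (1 - ψ y) ∂(μ t) :=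
    norm_integral_le_of_norm_le (((integrable_const _).sub iψ).const_mul _)
      (Eventually.of_forall rem)
  rw [integral_const_mul, Real.norm_eq_abs] at b1
  rw [split]
  refine (abs_add_le _ _).trans ?_
  rw [abs_mul]
  have b2 := mul_le_mul (hf.bound_deriv x) bθ (abs_nonneg _) hM
  have b3 := mul_le_mul_of_nonneg_left bψ (by positivity : 0 ≤ 3 * M)
  linarith

/-- For `f ∈ C₀²` the difference quotients of the semigroup converge uniformly to the
integro-differential operator. -/
theorem IsLevyFamily.eventually_abs_quotient_sub_le [SFinite ν] (hμ : IsLevyFamily μ A γ ν)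
    (hf : IsC0n 2 f) {ε : ℝ} (hε : 0 < ε) :
    ∀ᶠ t : ℝ≥0 in 𝓝[>] 0, ∀ x,
      |(t : ℝ)⁻¹ * (∫ y, f (x + y) ∂(μ t) - f x) - levyOp A γ ν f x| ≤ ε := by
  obtain ⟨M, hM⟩ := exists_c2Bounded_of_tendsto hf
  obtain ⟨c1, hc1, h1⟩ := hμ.exists_abs_integral_sub_le
  obtain ⟨c2, hc2, h2⟩ := exists_abs_levyOp_le A γ hμ.levyMeasure
  set δ := ε / 2 / (c1 + c2 + 1) with hδ
  have hδ0 : 0 < δ := by positivity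
  have hδc : (c1 + c2) * δ ≤ ε / 2 := by
    rw [hδ, ← mul_div_assoc, div_le_iff₀ (by positivity)]
    nlinarith
  obtain ⟨g, hgc, hg, hfg⟩ := exists_smooth_c2Bounded_sub hf hδ0
  obtain ⟨N, hN⟩ := exists_c2Bounded_of_hasCompactSupport (contDiff_infty.1 hg 2) hgc
  obtain ⟨h, hF⟩ := exists_isFourierIntegral hgc hg
  filter_upwards [hF.eventually_abs_quotient_sub_le hμ (half_pos hε), self_mem_nhdsWithin]
    with t ht ht0 x
  have ht0' : (0 : ℝ) < t := ht0
  have ifx : Integrable (fun y => f (x + y)) (μ t) :=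
    hμ.integrable_of_bounded t (hf.1.continuous.comp (by fun_prop)) fun y => hM.bound _
  have igx : Integrable (fun y => g (x + y)) (μ t) :=
    hμ.integrable_of_bounded t (hg.continuous.comp (by fun_prop)) fun y => hN.bound _
  have a1 := h1 _ _ hfg t x
  rw [integral_sub ifx igx] at a1
  have a2 := h2 _ _ hfg x
  rw [hM.levyOp_sub hN hμ.levyMeasure] at a2
  have a3 := ht x
  set If := ∫ y, f (x + y) ∂(μ t)
  set Ig := ∫ y, g (x + y) ∂(μ t)
  have a4 : |(t : ℝ)⁻¹ * ((If - Ig) - (f x - g x))| ≤ c1 * δ := by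
    rw [abs_mul, abs_of_pos (inv_pos.2 ht0'), inv_mul_le_iff₀ ht0']
    linarith
  have e : (t : ℝ)⁻¹ * (If - f x) - levyOp A γ ν f x
      = (t : ℝ)⁻¹ * ((If - Ig) - (f x - g x)) + ((t : ℝ)⁻¹ * (Ig - g x) - levyOp A γ ν g x)
        - (levyOp A γ ν f x - levyOp A γ ν g x) := by ring
  rw [e]
  refine (abs_sub _ _).trans ?_
  have := abs_add_le ((t : ℝ)⁻¹ * ((If - Ig) - (f x - g x)))
    ((t : ℝ)⁻¹ * (Ig - g x) - levyOp A γ ν g x)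
  linarith

/-! ### The generator -/

theorem isLevyFamily_map {Ω : Type*} [MeasurableSpace Ω] {P : Measure Ω} [IsProbabilityMeasure P]
    {X : ℝ≥0 → Ω → ℝ} (hX : ∀ t, Measurable (X t)) (hT : HasLevyTriplet P X A γ ν) :
    IsLevyFamily (fun t => P.map (X t)) A γ ν where
  prob t := Measure.isProbabilityMeasure_map (hX t).aemeasurable
  levyMeasure := hT.levyMeasure
  charFun_eq t z := by
    rw [← hT.charFun_eq, integral_map (hX t).aemeasurable]
    exact (by fun_prop : Continuous fun y : ℝ =>
      Complex.exp (Complex.I * z * y)).aestronglyMeasurable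

/-- `C₀²` is contained in the domain of the generator, which acts on it as the
integro-differential operator. -/
theorem exists_mem_domain_generator {Ω : Type*} [MeasurableSpace Ω] {P : Measure Ω}
    [IsProbabilityMeasure P] {X : ℝ≥0 → Ω → ℝ} [SFinite ν] (hX : ∀ t, Measurable (X t))
    (hT : HasLevyTriplet P X A γ ν) (f : C₀(ℝ, ℝ)) (hf : IsC0n 2 f) :
    ∃ hd : f ∈ (generator (transitionOp P X)).domain, ∀ x,
      generator (transitionOp P X) ⟨f, hd⟩ x = levyOp A γ ν f x := by
  have hμ := isLevyFamily_map hX hT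
  let D : ℝ≥0 → C₀(ℝ, ℝ) := fun t => (t : ℝ)⁻¹ • (transitionOp P X t f - f)
  have hD : ∀ t x, D t x = (t : ℝ)⁻¹ * (∫ y, f (x + y) ∂(P.map (X t)) - f x) := fun t x => rfl
  have hconv : ∀ ε > 0, ∀ᶠ t in 𝓝[>] (0 : ℝ≥0), ∀ x, |D t x - levyOp A γ ν f x| ≤ ε := by
    intro ε hε
    filter_upwards [hμ.eventually_abs_quotient_sub_le hf hε] with t ht x
    rw [hD]
    exact ht x
  have hpt : ∀ x, Tendsto (fun t => D t x) (𝓝[>] 0) (𝓝 (levyOp A γ ν f x)) := by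
    intro x
    rw [Metric.tendsto_nhds]
    intro ε hε
    filter_upwards [hconv (ε / 2) (half_pos hε)] with t ht
    rw [Real.dist_eq]
    linarith [ht x]
  have hcauchy : Cauchy (map D (𝓝[>] 0)) := by
    rw [Metric.cauchy_iff]
    refine ⟨inferInstance, fun ε hε => ?_⟩
    refine ⟨_, image_mem_map (hconv (ε / 4) (by positivity)), ?_⟩
    rintro _ ⟨t, ht, rfl⟩ _ ⟨s, hs, rfl⟩
    rw [← ZeroAtInftyContinuousMap.dist_toBCF_eq_dist]
    refine lt_of_le_of_lt ((BoundedContinuousFunction.dist_le (C := ε / 2) (by positivity)).2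
      fun x => ?_) (half_lt_self hε)
    have h1 := ht x
    have h2 := hs x
    rw [abs_le] at h1 h2
    change dist (D t x) (D s x) ≤ _
    rw [Real.dist_eq, abs_le]
    constructor <;> linarith
  obtain ⟨G, hG⟩ := CompleteSpace.complete hcauchy
  have hG' : IsGeneratorLimit (transitionOp P X) f G := hG
  refine ⟨⟨G, hG'⟩, fun x => ?_⟩
  have h1 : Tendsto D (𝓝[>] 0) (𝓝 (generator (transitionOp P X) ⟨f, ⟨G, hG'⟩⟩)) :=
    generator_spec (transitionOp P X) ⟨f, ⟨G, hG'⟩⟩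
  exact tendsto_nhds_unique
    ((ZeroAtInftyContinuousMap.tendsto_iff_tendstoUniformly.1 h1).tendsto_at x) (hpt x)

end

section

variable {n : ℝ → ℝ} {f : ℝ → ℝ} {M c : ℝ}

/-! ### One-sided kernels -/

/-- The compensated kernel `∫_u^∞ (t - u) n(t) dt`, for `u > 0`. -/
def tailKernel (n : ℝ → ℝ) (u : ℝ) : ℝ := ∫ t in Ioi u, (t - u) * n t

/-- The uncompensated kernel `∫_0^∞ min(t, u) n(t) dt`, for `u > 0`. -/
def minKernel (n : ℝ → ℝ) (u : ℝ) : ℝ := ∫ t in Ioi 0, min t u * n t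

theorem tailKernel_eq {a u : ℝ} (hu : a ≤ u) :
    tailKernel n u = ∫ t in Ioi a, max (t - u) 0 * n t := by
  have h1 : tailKernel n u = ∫ t in Ioi u, max (t - u) 0 * n t :=
    setIntegral_congr_fun measurableSet_Ioi fun t ht => by
      rw [max_eq_left (sub_nonneg.2 (le_of_lt ht))]
  rw [h1]
  refine (setIntegral_eq_of_subset_of_forall_sdiff_eq_zero measurableSet_Ioi
    (Ioi_subset_Ioi hu) fun t ht => ?_).symm
  rw [max_eq_right (sub_nonpos.2 (not_lt.1 ht.2)), zero_mul]

/-- Fubini's theorem for a kernel `∫ w(u, t) dt` with `w ≥ 0`: absolute convergence of the outer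
integral alone suffices. -/
theorem integral_kernel_mul {w : ℝ → ℝ → ℝ} (hw : Measurable (Function.uncurry w))
    {m : Measure ℝ} [SFinite m] (hw0 : ∀ᵐ u ∂m, ∀ᵐ t ∂m, 0 ≤ w u t)
    (hwi : ∀ᵐ u ∂m, Integrable (w u) m) {φ : ℝ → ℝ} (hφ : Measurable φ)
    (hi : Integrable (fun u => (∫ t, w u t ∂m) * φ u) m) :
    ∫ u, (∫ t, w u t ∂m) * φ u ∂m = ∫ t, ∫ u, w u t * φ u ∂m ∂m ∧
      Integrable (fun t => ∫ u, w u t * φ u ∂m) m := by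
  have hI : Integrable (Function.uncurry fun u t => w u t * φ u) (m.prod m) := by
    have hm : AEStronglyMeasurable (Function.uncurry fun u t => w u t * φ u) (m.prod m) :=
      (hw.mul (hφ.comp measurable_fst)).aestronglyMeasurable
    refine (integrable_prod_iff hm).2 ⟨?_, ?_⟩
    · filter_upwards [hwi] with u hu
      exact hu.mul_const (φ u)
    · refine hi.norm.congr ?_
      filter_upwards [hw0] with u hu
      simp only [Function.uncurry, norm_mul]
      rw [integral_mul_const, Real.norm_of_nonneg (integral_nonneg_of_ae hu)]
      congr 1
      refine integral_congr_ae ?_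
      filter_upwards [hu] with t ht
      rw [Real.norm_of_nonneg ht]
  refine ⟨?_, hI.integral_prod_right⟩
  rw [← integral_integral_swap hI]
  simp only [integral_mul_const]

theorem integrableOn_mul_of_le {s : Set ℝ} (hs : MeasurableSet s) (hn : Measurable n)
    (hn0 : ∀ y, 0 ≤ n y) {a b : ℝ → ℝ} (ha : Measurable a) (K : ℝ)
    (hab : ∀ t ∈ s, |a t| ≤ K * b t) (hb : IntegrableOn (fun t => b t * n t) s) :
    IntegrableOn (fun t => a t * n t) s := by
  refine (hb.const_mul K).mono' (ha.mul hn).aestronglyMeasurable ?_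
  filter_upwards [ae_restrict_mem hs] with t ht
  rw [norm_mul, Real.norm_eq_abs, Real.norm_of_nonneg (hn0 t), ← mul_assoc]
  exact mul_le_mul_of_nonneg_right (hab t ht) (hn0 t)

theorem integrableOn_max_sub_mul (hn : Measurable n) (hn0 : ∀ y, 0 ≤ n y)
    (hi : IntegrableOn (fun t => min (t ^ 2) t * n t) (Ioi 0)) {u : ℝ} (hu : 0 < u) :
    IntegrableOn (fun t => max (t - u) 0 * n t) (Ioi 0) := by
  refine integrableOn_mul_of_le measurableSet_Ioi hn hn0 (by fun_prop) (1 / u + 1) ?_ hi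
  intro t ht
  have ht : 0 < t := ht
  rw [abs_of_nonneg (le_max_right _ _)]
  have h1 : 0 < 1 / u := by positivity
  rcases le_total (t - u) 0 with h | h
  · rw [max_eq_right h]; positivity
  · rw [max_eq_left h]
    have h2 : t ≤ 1 / u * t ^ 2 := by
      rw [one_div, ← div_eq_inv_mul, le_div_iff₀ hu]
      nlinarith
    rcases le_total (t ^ 2) t with h' | h'
    · rw [min_eq_left h']
      nlinarith [sq_nonneg t]
    · rw [min_eq_right h']
      nlinarith [mul_pos h1 ht]

theorem integrableOn_min_mul (hn : Measurable n) (hn0 : ∀ y, 0 ≤ n y)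
    (hi : IntegrableOn (fun t => min t 1 * n t) (Ioi 0)) {u : ℝ} (hu : 0 ≤ u) :
    IntegrableOn (fun t => min t u * n t) (Ioi 0) := by
  refine integrableOn_mul_of_le measurableSet_Ioi hn hn0 (by fun_prop) (u + 1) ?_ hi
  intro t ht
  have ht : 0 < t := ht
  rw [abs_of_nonneg (le_min ht.le hu)]
  rcases le_total t 1 with h | h
  · rw [min_eq_left h]
    have := min_le_left t u
    nlinarith
  · rw [min_eq_right h]
    have := min_le_right t u
    nlinarith

theorem exists_hasDerivAt_eq (hf : Continuous f) : ∃ Φ : ℝ → ℝ, ∀ x, HasDerivAt Φ (f x) x :=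
  ⟨fun x => ∫ t in (0 : ℝ)..x, f t, fun _ =>
    intervalIntegral.integral_hasDerivAt_right (hf.intervalIntegrable _ _)
      (hf.stronglyMeasurableAtFilter _ _) hf.continuousAt⟩

/-- Integration by parts; `Φ` is a primitive of `f`. -/
theorem integral_max_sub_mul_deriv (hf : ContDiff ℝ 2 f) {Φ : ℝ → ℝ}
    (hΦ : ∀ x, HasDerivAt Φ (f x) x) (x : ℝ) {t : ℝ} (ht : 0 ≤ t) :
    ∫ u in Ioi 0, max (t - u) 0 * deriv f (x + u) = Φ (x + t) - Φ x - t * f x := by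
  have hc := (contDiff_deriv_of_contDiff_two hf).continuous
  have h1 : ∫ u in Ioi 0, max (t - u) 0 * deriv f (x + u)
      = ∫ u in Ioc 0 t, max (t - u) 0 * deriv f (x + u) := by
    refine setIntegral_eq_of_subset_of_forall_sdiff_eq_zero measurableSet_Ioi
      Ioc_subset_Ioi_self fun u hu => ?_
    have : ¬ u ≤ t := fun h => hu.2 ⟨hu.1, h⟩
    rw [max_eq_right (by linarith), zero_mul]
  have h2 : ∫ u in Ioc 0 t, max (t - u) 0 * deriv f (x + u)
      = ∫ u in (0 : ℝ)..t, (t - u) * deriv f (x + u) := by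
    rw [intervalIntegral.integral_of_le ht]
    refine setIntegral_congr_fun measurableSet_Ioc fun u hu => ?_
    rw [max_eq_left (by linarith [hu.2])]
  rw [h1, h2, intervalIntegral.integral_eq_sub_of_hasDerivAt
    (f := fun u => (t - u) * f (x + u) + Φ (x + u)) (fun u _ => ?_)
    (Continuous.intervalIntegrable (by fun_prop) _ _)]
  · simp
    ring
  · have d1 : HasDerivAt (fun u => f (x + u)) (deriv f (x + u)) u :=
      (hasDerivAt_of_contDiff_two hf (x + u)).comp_const_add x u
    have d2 : HasDerivAt (fun u => Φ (x + u)) (f (x + u)) u := (hΦ (x + u)).comp_const_add x u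
    refine ((((hasDerivAt_id u).const_sub t).mul d1).add d2).congr_deriv ?_
    simp

/-- The compensated kernel represents the compensated jump operator. By Fubini's theorem and
integration by parts, the convolution is `∫ (Φ(x + t) - Φ(x) - t f(x)) n(t) dt` for a primitive `Φ`
of `f`, and this integral can be differentiated in `x` because `|f(x + t) - f(x) - t f'(x)|` is at
most a multiple of `min (t², t)`. -/
theorem hasDerivAt_integral_tailKernel (hn : Measurable n) (hn0 : ∀ y, 0 ≤ n y)
    (hi : IntegrableOn (fun t => min (t ^ 2) t * n t) (Ioi 0)) (hf : C2Bounded f M)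
    (hk : ∀ x, IntegrableOn (fun u => tailKernel n u * deriv f (x + u)) (Ioi 0)) (x : ℝ) :
    HasDerivAt (fun x => ∫ u in Ioi 0, tailKernel n u * deriv f (x + u))
      (∫ t in Ioi 0, (f (x + t) - f x - t * deriv f x) * n t) x := by
  obtain ⟨Φ, hΦ⟩ := exists_hasDerivAt_eq hf.contDiff.continuous
  have hc := (contDiff_deriv_of_contDiff_two hf.contDiff).continuous
  have hc0 := hf.contDiff.continuous
  have hcΦ : Continuous Φ := continuous_iff_continuousAt.2 fun y => (hΦ y).continuousAt
  have hw : Measurable (Function.uncurry fun u t : ℝ => max (t - u) 0 * n t) := by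
    unfold Function.uncurry
    fun_prop
  have key : ∀ x, ∫ u in Ioi 0, tailKernel n u * deriv f (x + u)
      = ∫ t in Ioi 0, (Φ (x + t) - Φ x - t * f x) * n t ∧
      IntegrableOn (fun t => (Φ (x + t) - Φ x - t * f x) * n t) (Ioi 0) := by
    intro x
    have e1 : ∀ u ∈ Ioi (0 : ℝ), tailKernel n u * deriv f (x + u)
        = (∫ t in Ioi 0, max (t - u) 0 * n t) * deriv f (x + u) := fun u hu => by
      rw [tailKernel_eq (le_of_lt hu)]
    have e2 : ∀ t ∈ Ioi (0 : ℝ), ∫ u in Ioi 0, max (t - u) 0 * n t * deriv f (x + u)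
        = (Φ (x + t) - Φ x - t * f x) * n t := fun t ht => by
      rw [← integral_max_sub_mul_deriv hf.contDiff hΦ x (le_of_lt ht), ← integral_mul_const]
      congr 1
      ext u
      ring
    obtain ⟨a, b⟩ := integral_kernel_mul (m := volume.restrict (Ioi 0)) hw
      (Eventually.of_forall fun u => Eventually.of_forall fun t =>
        mul_nonneg (le_max_right _ _) (hn0 t))
      (by filter_upwards [ae_restrict_mem measurableSet_Ioi] with u hu using
        integrableOn_max_sub_mul hn hn0 hi hu)
      (φ := fun u => deriv f (x + u)) (by fun_prop)
      ((hk x).congr_fun e1 measurableSet_Ioi)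
    rw [setIntegral_congr_fun measurableSet_Ioi e1, a]
    exact ⟨setIntegral_congr_fun measurableSet_Ioi e2,
      IntegrableOn.congr_fun b e2 measurableSet_Ioi⟩
  simp only [fun x => (key x).1]
  have hM := hf.nonneg
  refine (hasDerivAt_integral_of_dominated_loc_of_deriv_le
    (F' := fun x t => (f (x + t) - f x - t * deriv f x) * n t)
    (bound := fun t => 3 * M * (min (t ^ 2) t * n t)) (s := univ) univ_mem
    (Eventually.of_forall fun x => (key x).2.aestronglyMeasurable) (key x).2
    (by fun_prop) ?_ (hi.const_mul _) (Eventually.of_forall fun t x _ => ?_)).2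
  · filter_upwards [ae_restrict_mem measurableSet_Ioi] with t ht x _
    have ht : 0 < t := ht
    rw [norm_mul, Real.norm_of_nonneg (hn0 t), ← mul_assoc]
    refine mul_le_mul_of_nonneg_right ?_ (hn0 t)
    rcases le_total (t ^ 2) t with h | h
    · rw [min_eq_left h]
      have := norm_taylor_le (hasDerivAt_of_contDiff_two hf.contDiff)
        (hasDerivAt_deriv_of_contDiff_two hf.contDiff) hf.bound_deriv2 x t
      rw [smul_eq_mul] at this
      refine this.trans ?_
      nlinarith [mul_nonneg hM (sq_nonneg t)]
    · rw [min_eq_right h]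
      have ht1 : 1 ≤ t := by nlinarith
      have e1 := norm_sub_le (f (x + t) - f x) (t * deriv f x)
      have e2 := norm_sub_le (f (x + t)) (f x)
      have e3 : ‖t * deriv f x‖ ≤ t * M := by
        rw [norm_mul, Real.norm_of_nonneg ht.le]
        exact mul_le_mul_of_nonneg_left (hf.bound_deriv x) ht.le
      have e4 := hf.bound (x + t)
      have e5 := hf.bound x
      simp only [Real.norm_eq_abs] at *
      nlinarith [mul_le_mul_of_nonneg_left ht1 hM]
  · have d1 : HasDerivAt (fun x => Φ (x + t)) (f (x + t)) x := (hΦ (x + t)).comp_add_const x t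
    exact ((d1.sub (hΦ x)).sub
      ((hasDerivAt_of_contDiff_two hf.contDiff x).const_mul t)).mul_const _

theorem integral_Ioi_deriv_add (hf : ContDiff ℝ 2 f) (hlim : Tendsto f atTop (𝓝 0)) (x : ℝ)
    (hi : IntegrableOn (fun u => deriv f (x + u)) (Ioi 0)) :
    ∫ u in Ioi 0, deriv f (x + u) = -f x := by
  have := integral_Ioi_of_hasDerivAt_of_tendsto' (a := 0) (f := fun u => f (x + u)) (m := 0)
    (fun u _ => (hasDerivAt_of_contDiff_two hf (x + u)).comp_const_add x u) hi
    (hlim.comp (tendsto_atTop_add_const_left _ x tendsto_id))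
  simpa using this

/-- The uncompensated kernel represents the uncompensated jump operator: the convolution is
`-∫ (Φ(x + t) - Φ(x)) n(t) dt` for a primitive `Φ` of `f`. -/
theorem hasDerivAt_integral_minKernel (hn : Measurable n) (hn0 : ∀ y, 0 ≤ n y)
    (hi : IntegrableOn (fun t => min t 1 * n t) (Ioi 0)) (hf : C2Bounded f M)
    (hlim : Tendsto f atTop (𝓝 0))
    (hf' : ∀ x, IntegrableOn (fun u => deriv f (x + u)) (Ioi 0))
    (hk : ∀ x, IntegrableOn (fun u => minKernel n u * deriv f (x + u)) (Ioi 0)) (x : ℝ) :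
    HasDerivAt (fun x => ∫ u in Ioi 0, minKernel n u * deriv f (x + u))
      (-∫ t in Ioi 0, (f (x + t) - f x) * n t) x := by
  obtain ⟨Φ, hΦ⟩ := exists_hasDerivAt_eq hf.contDiff.continuous
  have hc := (contDiff_deriv_of_contDiff_two hf.contDiff).continuous
  have hc0 := hf.contDiff.continuous
  have hcΦ : Continuous Φ := continuous_iff_continuousAt.2 fun y => (hΦ y).continuousAt
  have hw : Measurable (Function.uncurry fun u t : ℝ => min t u * n t) := by
    unfold Function.uncurry
    fun_prop
  have hinner : ∀ x, ∀ t ∈ Ioi (0 : ℝ), ∫ u in Ioi 0, min t u * deriv f (x + u)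
      = -(Φ (x + t) - Φ x) := by
    intro x t ht
    have ht : 0 < t := ht
    -- `min t u = t - max (t - u) 0` reduces the integral to the compensated case.
    have e : ∀ u, min t u * deriv f (x + u)
        = t * deriv f (x + u) - max (t - u) 0 * deriv f (x + u) := by
      intro u
      rw [← sub_mul]
      congr 1
      rcases le_total t u with h | h
      · rw [min_eq_left h, max_eq_right (by linarith), sub_zero]
      · rw [min_eq_right h, max_eq_left (by linarith)]; ring
    have hmax : IntegrableOn (fun u => max (t - u) 0 * deriv f (x + u)) (Ioi 0) := by
      refine ((hf' x).norm.const_mul t).mono' (by fun_prop) ?_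
      filter_upwards [ae_restrict_mem measurableSet_Ioi] with u hu
      rw [norm_mul, Real.norm_of_nonneg (le_max_right _ _)]
      refine mul_le_mul_of_nonneg_right (max_le ?_ ht.le) (norm_nonneg _)
      have : 0 < u := hu
      linarith
    simp only [e]
    rw [integral_sub ((hf' x).const_mul t) hmax, integral_const_mul,
      integral_Ioi_deriv_add hf.contDiff hlim x (hf' x),
      integral_max_sub_mul_deriv hf.contDiff hΦ x ht.le]
    ring
  have key : ∀ x, ∫ u in Ioi 0, minKernel n u * deriv f (x + u)
      = ∫ t in Ioi 0, (-(Φ (x + t) - Φ x)) * n t ∧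
      IntegrableOn (fun t => (-(Φ (x + t) - Φ x)) * n t) (Ioi 0) := by
    intro x
    have e2 : ∀ t ∈ Ioi (0 : ℝ), ∫ u in Ioi 0, min t u * n t * deriv f (x + u)
        = (-(Φ (x + t) - Φ x)) * n t := fun t ht => by
      rw [← hinner x t ht, ← integral_mul_const]
      congr 1
      ext u
      ring
    obtain ⟨a, b⟩ := integral_kernel_mul (m := volume.restrict (Ioi 0)) hw
      (by
        filter_upwards [ae_restrict_mem measurableSet_Ioi] with u hu
        filter_upwards [ae_restrict_mem measurableSet_Ioi] with t ht
        exact mul_nonneg (le_min (le_of_lt ht) (le_of_lt hu)) (hn0 t))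
      (by filter_upwards [ae_restrict_mem measurableSet_Ioi] with u hu using
        integrableOn_min_mul hn hn0 hi (le_of_lt hu))
      (φ := fun u => deriv f (x + u)) (by fun_prop) (hk x)
    unfold minKernel
    rw [a]
    exact ⟨setIntegral_congr_fun measurableSet_Ioi e2,
      IntegrableOn.congr_fun b e2 measurableSet_Ioi⟩
  simp only [fun x => (key x).1]
  have hM := hf.nonneg
  have e3 : -∫ t in Ioi 0, (f (x + t) - f x) * n t
      = ∫ t in Ioi 0, (-(f (x + t) - f x)) * n t := by
    rw [← integral_neg]
    simp only [neg_mul]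
  rw [e3]
  refine (hasDerivAt_integral_of_dominated_loc_of_deriv_le
    (F' := fun x t => (-(f (x + t) - f x)) * n t)
    (bound := fun t => 2 * M * (min t 1 * n t)) (s := univ) univ_mem
    (Eventually.of_forall fun x => (key x).2.aestronglyMeasurable) (key x).2
    (by fun_prop) ?_ (hi.const_mul _) (Eventually.of_forall fun t x _ => ?_)).2
  · filter_upwards [ae_restrict_mem measurableSet_Ioi] with t ht x _
    have ht : 0 < t := ht
    rw [norm_mul, Real.norm_of_nonneg (hn0 t), norm_neg, ← mul_assoc]
    refine mul_le_mul_of_nonneg_right ?_ (hn0 t)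
    rcases le_total t 1 with h | h
    · rw [min_eq_left h]
      have := convex_univ.norm_image_sub_le_of_norm_hasDerivWithin_le
        (fun z _ => (hasDerivAt_of_contDiff_two hf.contDiff z).hasDerivWithinAt)
        (fun z _ => hf.bound_deriv z) (mem_univ x) (mem_univ (x + t))
      rw [add_sub_cancel_left, Real.norm_of_nonneg ht.le] at this
      refine this.trans ?_
      nlinarith [mul_nonneg hM ht.le]
    · rw [min_eq_right h]
      have e2 := norm_sub_le (f (x + t)) (f x)
      have e4 := hf.bound (x + t)
      have e5 := hf.bound x
      simp only [Real.norm_eq_abs] at *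
      linarith
  · have d1 : HasDerivAt (fun x => Φ (x + t)) (f (x + t)) x := (hΦ (x + t)).comp_add_const x t
    exact ((d1.sub (hΦ x)).neg).mul_const _

end

section

variable {n : ℝ → ℝ} {f : ℝ → ℝ} {M c : ℝ}

/-! ### Integrability of `f'` against kernels that do not vanish at infinity -/

theorem tendsto_tailKernel_atTop (hn : Measurable n) (hn0 : ∀ y, 0 ≤ n y)
    (hi : IntegrableOn (fun t => min (t ^ 2) t * n t) (Ioi 0)) :
    Tendsto (tailKernel n) atTop (𝓝 0) := by
  have h1 : Tendsto (fun u : ℝ => ∫ t in Ioi 0, max (t - u) 0 * n t) atTop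
      (𝓝 (∫ t in Ioi (0 : ℝ), (0 : ℝ))) := by
    refine tendsto_integral_filter_of_dominated_convergence (fun t => max (t - 1) 0 * n t)
      (Eventually.of_forall fun u => (by fun_prop)) ?_
      (integrableOn_max_sub_mul hn hn0 hi one_pos) (Eventually.of_forall fun t => ?_)
    · filter_upwards [eventually_ge_atTop 1] with u hu
      refine Eventually.of_forall fun t => ?_
      rw [Real.norm_of_nonneg (mul_nonneg (le_max_right _ _) (hn0 t))]
      exact mul_le_mul_of_nonneg_right (max_le_max (by linarith) le_rfl) (hn0 t)
    · refine tendsto_const_nhds.congr' ?_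
      filter_upwards [eventually_ge_atTop t] with u hu
      rw [max_eq_right (by linarith), zero_mul]
  rw [integral_zero] at h1
  refine h1.congr' ?_
  filter_upwards [eventually_ge_atTop 0] with u hu
  rw [tailKernel_eq hu]

theorem integrableOn_deriv_of_le_abs (hf : ContDiff ℝ 2 f) {k : ℝ → ℝ} {ε : ℝ} (hε : 0 < ε)
    (hk : ∀ᶠ u in atTop, ε ≤ |k u|) {x : ℝ}
    (hi : IntegrableOn (fun u => k u * deriv f (x + u)) (Ioi 0)) :
    IntegrableOn (fun u => deriv f (x + u)) (Ioi 0) := by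
  have hc := (contDiff_deriv_of_contDiff_two hf).continuous
  obtain ⟨R, hR⟩ := eventually_atTop.1 hk
  have h1 : IntegrableOn (fun u => deriv f (x + u)) (Ioc 0 (max R 0)) :=
    ((by fun_prop : Continuous fun u => deriv f (x + u)).integrableOn_Icc).mono_set
      Ioc_subset_Icc_self
  have h2 : IntegrableOn (fun u => deriv f (x + u)) (Ioi (max R 0)) := by
    refine ((hi.mono_set (Ioi_subset_Ioi (le_max_right R 0))).norm.const_mul ε⁻¹).mono'
      (by fun_prop) ?_
    filter_upwards [ae_restrict_mem measurableSet_Ioi] with u hu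
    have := hR u ((le_max_left R 0).trans (le_of_lt hu))
    rw [norm_mul, ← div_eq_inv_mul, le_div_iff₀ hε, mul_comm]
    exact mul_le_mul_of_nonneg_right this (norm_nonneg _)
  rw [← Ioc_union_Ioi_eq_Ioi (le_max_right R 0)]
  exact h1.union h2

/-- If `c ≠ 0`, the kernel tends to `c` at infinity, so convergence of the integral forces `f'` to be
integrable, and the two summands of the kernel can be treated separately. -/
theorem hasDerivAt_integral_tailKernel_add (hn : Measurable n) (hn0 : ∀ y, 0 ≤ n y)
    (hi : IntegrableOn (fun t => min (t ^ 2) t * n t) (Ioi 0)) (hf : C2Bounded f M)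
    (hlim : Tendsto f atTop (𝓝 0)) (c : ℝ)
    (hk : ∀ x, IntegrableOn (fun u => (tailKernel n u + c) * deriv f (x + u)) (Ioi 0)) (x : ℝ) :
    HasDerivAt (fun x => ∫ u in Ioi 0, (tailKernel n u + c) * deriv f (x + u))
      ((∫ t in Ioi 0, (f (x + t) - f x - t * deriv f x) * n t) - c * deriv f x) x := by
  rcases eq_or_ne c 0 with rfl | hc
  · simp only [add_zero, zero_mul, sub_zero] at hk ⊢
    exact hasDerivAt_integral_tailKernel hn hn0 hi hf hk x
  have hlow : ∀ᶠ u in atTop, |c| / 2 ≤ |tailKernel n u + c| := by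
    have h := ((tendsto_tailKernel_atTop hn hn0 hi).add_const c).abs
    rw [zero_add] at h
    exact h.eventually_const_le (half_lt_self (abs_pos.2 hc))
  have hf' : ∀ x, IntegrableOn (fun u => deriv f (x + u)) (Ioi 0) := fun x =>
    integrableOn_deriv_of_le_abs hf.contDiff (half_pos (abs_pos.2 hc)) hlow (hk x)
  have hK : ∀ x, IntegrableOn (fun u => tailKernel n u * deriv f (x + u)) (Ioi 0) := fun x =>
    ((hk x).sub ((hf' x).const_mul c)).congr (Eventually.of_forall fun u => by
      simp only [Pi.sub_apply]; ring)
  have e : ∀ x, ∫ u in Ioi 0, (tailKernel n u + c) * deriv f (x + u)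
      = (∫ u in Ioi 0, tailKernel n u * deriv f (x + u)) - c * f x := by
    intro x
    simp only [add_mul]
    rw [integral_add (hK x) ((hf' x).const_mul c), integral_const_mul,
      integral_Ioi_deriv_add hf.contDiff hlim x (hf' x)]
    ring
  simp only [e]
  exact (hasDerivAt_integral_tailKernel hn hn0 hi hf hK x).sub
    ((hasDerivAt_of_contDiff_two hf.contDiff x).const_mul c)

theorem minKernel_mono (hn : Measurable n) (hn0 : ∀ y, 0 ≤ n y)
    (hi : IntegrableOn (fun t => min t 1 * n t) (Ioi 0)) {u v : ℝ} (hu : 0 ≤ u) (huv : u ≤ v) :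
    minKernel n u ≤ minKernel n v :=
  setIntegral_mono (integrableOn_min_mul hn hn0 hi hu)
    (integrableOn_min_mul hn hn0 hi (hu.trans huv)) fun t =>
    mul_le_mul_of_nonneg_right (min_le_min le_rfl huv) (hn0 t)

/-- If the uncompensated kernel is bounded, the density has a finite first moment, which is its
limit. -/
theorem integrableOn_and_eq_of_tendsto_minKernel (hn : Measurable n) (hn0 : ∀ y, 0 ≤ n y)
    (hi : IntegrableOn (fun t => min t 1 * n t) (Ioi 0)) {l : ℝ}
    (hl : Tendsto (minKernel n) atTop (𝓝 l)) :
    IntegrableOn (fun t => t * n t) (Ioi 0) ∧ ∫ t in Ioi 0, t * n t = l := by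
  have hle : ∀ u, 0 ≤ u → minKernel n u ≤ l := fun u hu =>
    ge_of_tendsto hl (by
      filter_upwards [eventually_ge_atTop u] with v hv using minKernel_mono hn hn0 hi hu hv)
  have hcongr : ∀ N : ℝ, ∀ t ∈ Ioc 0 N, min t N * n t = t * n t := fun N t ht => by
    rw [min_eq_left ht.2]
  have hint : ∀ N : ℝ, IntegrableOn (fun t => t * n t) (Ioc 0 N) := by
    intro N
    rcases le_total N 0 with h | h
    · simp [Ioc_eq_empty_of_le h]
    · exact ((integrableOn_min_mul hn hn0 hi h).mono_set Ioc_subset_Ioi_self).congr_fun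
        (hcongr N) measurableSet_Ioc
  have hI : IntegrableOn (fun t => t * n t) (Ioi 0) := by
    refine integrableOn_Ioi_of_intervalIntegral_norm_bounded l 0 hint tendsto_id ?_
    filter_upwards [eventually_ge_atTop 0] with N hN
    refine le_trans ?_ (hle N hN)
    change ∫ t in (0 : ℝ)..N, ‖t * n t‖ ≤ _
    rw [intervalIntegral.integral_of_le hN]
    have e : ∫ t in Ioc 0 N, ‖t * n t‖ = ∫ t in Ioc 0 N, min t N * n t :=
      setIntegral_congr_fun measurableSet_Ioc fun t ht => by
        rw [hcongr N t ht, Real.norm_of_nonneg (mul_nonneg ht.1.le (hn0 t))]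
    rw [e]
    refine setIntegral_mono_set (integrableOn_min_mul hn hn0 hi hN) ?_
      Ioc_subset_Ioi_self.eventuallyLE
    filter_upwards [ae_restrict_mem measurableSet_Ioi] with t ht
    exact mul_nonneg (le_min (le_of_lt ht) hN) (hn0 t)
  refine ⟨hI, tendsto_nhds_unique ?_ hl⟩
  refine tendsto_integral_filter_of_dominated_convergence (fun t => t * n t)
    (Eventually.of_forall fun u => (by fun_prop)) ?_ hI (Eventually.of_forall fun t => ?_)
  · filter_upwards [eventually_ge_atTop 0] with u hu
    filter_upwards [ae_restrict_mem measurableSet_Ioi] with t ht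
    rw [Real.norm_of_nonneg (mul_nonneg (le_min (le_of_lt ht) hu) (hn0 t))]
    exact mul_le_mul_of_nonneg_right (min_le_left _ _) (hn0 t)
  · refine tendsto_const_nhds.congr' ?_
    filter_upwards [eventually_ge_atTop t] with u hu
    rw [min_eq_left hu]

theorem integrableOn_sub_mul (hn : Measurable n) (hn0 : ∀ y, 0 ≤ n y)
    (hi : IntegrableOn (fun t => min t 1 * n t) (Ioi 0)) (hf : C2Bounded f M) (x : ℝ) :
    IntegrableOn (fun t => (f (x + t) - f x) * n t) (Ioi 0) := by
  have hc := hf.contDiff.continuous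
  have hM := hf.nonneg
  refine integrableOn_mul_of_le measurableSet_Ioi hn hn0 (by fun_prop) (2 * M) ?_ hi
  intro t ht
  have ht : 0 < t := ht
  rcases le_total t 1 with h | h
  · rw [min_eq_left h]
    have := convex_univ.norm_image_sub_le_of_norm_hasDerivWithin_le
      (fun z _ => (hasDerivAt_of_contDiff_two hf.contDiff z).hasDerivWithinAt)
      (fun z _ => hf.bound_deriv z) (mem_univ x) (mem_univ (x + t))
    rw [add_sub_cancel_left, Real.norm_of_nonneg ht.le] at this
    refine this.trans ?_
    nlinarith [mul_nonneg hM ht.le]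
  · rw [min_eq_right h]
    have e2 := abs_sub (f (x + t)) (f x)
    have e4 := hf.bound (x + t)
    have e5 := hf.bound x
    linarith

/-- The kernel `c - ∫_0^∞ min(t, u) n(t) dt` has a limit in `[-∞, ∞)` as `u → ∞`. If the limit is
not `0`, then convergence of the integral forces `f'` to be integrable. If it is `0`, the kernel
equals `∫_u^∞ (t - u) n(t) dt`, for which integrability of `f'` is not needed. -/
theorem hasDerivAt_integral_const_sub_minKernel (hn : Measurable n) (hn0 : ∀ y, 0 ≤ n y)
    (hi : IntegrableOn (fun t => min t 1 * n t) (Ioi 0)) (hf : C2Bounded f M)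
    (hlim : Tendsto f atTop (𝓝 0)) (c : ℝ)
    (hk : ∀ x, IntegrableOn (fun u => (c - minKernel n u) * deriv f (x + u)) (Ioi 0)) (x : ℝ) :
    HasDerivAt (fun x => ∫ u in Ioi 0, (c - minKernel n u) * deriv f (x + u))
      ((∫ t in Ioi 0, (f (x + t) - f x) * n t) - c * deriv f x) x := by
  have generic : ∀ ε : ℝ, 0 < ε → (∀ᶠ u in atTop, ε ≤ |c - minKernel n u|) →
      HasDerivAt (fun x => ∫ u in Ioi 0, (c - minKernel n u) * deriv f (x + u))
        ((∫ t in Ioi 0, (f (x + t) - f x) * n t) - c * deriv f x) x := by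
    intro ε hε hlow
    have hf' : ∀ x, IntegrableOn (fun u => deriv f (x + u)) (Ioi 0) := fun x =>
      integrableOn_deriv_of_le_abs hf.contDiff hε hlow (hk x)
    have hB : ∀ x, IntegrableOn (fun u => minKernel n u * deriv f (x + u)) (Ioi 0) := fun x =>
      (((hf' x).const_mul c).sub (hk x)).congr (Eventually.of_forall fun u => by
        simp only [Pi.sub_apply]; ring)
    have e : ∀ x, ∫ u in Ioi 0, (c - minKernel n u) * deriv f (x + u)
        = -(c * f x) - ∫ u in Ioi 0, minKernel n u * deriv f (x + u) := by
      intro x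
      simp only [sub_mul]
      rw [integral_sub ((hf' x).const_mul c) (hB x), integral_const_mul,
        integral_Ioi_deriv_add hf.contDiff hlim x (hf' x)]
      ring
    simp only [e]
    refine (((hasDerivAt_of_contDiff_two hf.contDiff x).const_mul c).neg.sub
      (hasDerivAt_integral_minKernel hn hn0 hi hf hlim hf' hB x)).congr_deriv ?_
    ring
  have hmono : Monotone fun u => minKernel n (max u 0) := fun u v huv =>
    minKernel_mono hn hn0 hi (le_max_right _ _) (max_le_max huv le_rfl)
  have hev : (fun u => minKernel n (max u 0)) =ᶠ[atTop] minKernel n := by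
    filter_upwards [eventually_ge_atTop 0] with u hu
    rw [max_eq_left hu]
  rcases tendsto_atTop_of_monotone hmono with htop | ⟨l, hl⟩
  · refine generic 1 one_pos ?_
    filter_upwards [(htop.congr' hev).eventually_ge_atTop (c + 1)] with u hu
    rw [abs_sub_comm]
    exact le_trans (by linarith) (le_abs_self _)
  · replace hl := hl.congr' hev
    rcases eq_or_ne l c with rfl | hlc
    · obtain ⟨hI, hl'⟩ := integrableOn_and_eq_of_tendsto_minKernel hn hn0 hi hl
      have hi2 : IntegrableOn (fun t => min (t ^ 2) t * n t) (Ioi 0) := by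
        refine integrableOn_mul_of_le measurableSet_Ioi hn hn0 (by fun_prop) 1 ?_ hI
        intro t ht
        rw [abs_of_nonneg (le_min (sq_nonneg t) (le_of_lt ht)), one_mul]
        exact min_le_right _ _
      have e : ∀ u ∈ Ioi (0 : ℝ), l - minKernel n u = tailKernel n u := by
        intro u hu
        rw [tailKernel_eq (le_of_lt hu), ← hl', minKernel,
          ← integral_sub hI (integrableOn_min_mul hn hn0 hi (le_of_lt hu))]
        refine integral_congr_ae (Eventually.of_forall fun t => ?_)
        dsimp only
        rw [← sub_mul]
        congr 1
        rcases le_total t u with h | h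
        · rw [min_eq_left h, max_eq_right (by linarith), sub_self]
        · rw [min_eq_right h, max_eq_left (by linarith)]
      have e' : ∀ x, ∀ u ∈ Ioi (0 : ℝ), (l - minKernel n u) * deriv f (x + u)
          = tailKernel n u * deriv f (x + u) := fun x u hu => by rw [e u hu]
      have hK : ∀ x, IntegrableOn (fun u => tailKernel n u * deriv f (x + u)) (Ioi 0) := fun x =>
        (hk x).congr_fun (e' x) measurableSet_Ioi
      have e'' : ∀ x, ∫ u in Ioi 0, (l - minKernel n u) * deriv f (x + u)
          = ∫ u in Ioi 0, tailKernel n u * deriv f (x + u) := fun x =>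
        setIntegral_congr_fun measurableSet_Ioi (e' x)
      simp only [e'']
      refine (hasDerivAt_integral_tailKernel hn hn0 hi2 hf hK x).congr_deriv ?_
      rw [← hl', ← integral_mul_const,
        ← integral_sub (integrableOn_sub_mul hn hn0 hi hf x) (hI.mul_const _)]
      refine integral_congr_ae (Eventually.of_forall fun t => ?_)
      dsimp only
      ring
    · have h0 : 0 < |c - l| := abs_pos.2 (sub_ne_zero.2 hlc.symm)
      exact generic (|c - l| / 2) (half_pos h0)
        ((hl.const_sub c).abs.eventually_const_le (half_lt_self h0))

/-! ### Local integrability of the kernels -/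

theorem integrableOn_minKernel (hn : Measurable n) (hn0 : ∀ y, 0 ≤ n y)
    (hi : IntegrableOn (fun t => min t 1 * n t) (Ioi 0)) (R : ℝ) :
    IntegrableOn (minKernel n) (Ioc 0 R) := by
  have h : MonotoneOn (minKernel n) (Icc 0 R) := fun u hu v _ huv =>
    minKernel_mono hn hn0 hi hu.1 huv
  exact (h.integrableOn_isCompact isCompact_Icc).mono_set Ioc_subset_Icc_self

/-- By Tonelli's theorem, from `∫_0^R max (t - u) 0 du ≤ (1 + R) min (t², t)`. -/
theorem integrableOn_tailKernel (hn : Measurable n) (hn0 : ∀ y, 0 ≤ n y)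
    (hi : IntegrableOn (fun t => min (t ^ 2) t * n t) (Ioi 0)) {R : ℝ} (hR : 0 < R) :
    IntegrableOn (tailKernel n) (Ioc 0 R) := by
  have hw : Measurable (Function.uncurry fun u t : ℝ => max (t - u) 0 * n t) := by
    unfold Function.uncurry
    fun_prop
  have hslice : ∀ t, IntegrableOn (fun u => max (t - u) 0 * n t) (Ioc 0 R) := fun t =>
    ((by fun_prop : Continuous fun u => max (t - u) 0 * n t).integrableOn_Icc).mono_set
      Ioc_subset_Icc_self
  have hbd : ∀ t ∈ Ioi (0 : ℝ), ∫ u in Ioc 0 R, max (t - u) 0 ≤ (1 + R) * min (t ^ 2) t := by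
    intro t ht
    have ht : 0 < t := ht
    have hci : ∀ a b : ℝ, IntegrableOn (fun u => max (t - u) 0) (Ioc a b) := fun a b =>
      ((by fun_prop : Continuous fun u => max (t - u) 0).integrableOn_Icc).mono_set
        Ioc_subset_Icc_self
    have hmax : ∀ u ∈ Ioi (0 : ℝ), max (t - u) 0 ≤ t := fun u hu => max_le (by
      have : 0 < u := hu
      linarith) ht.le
    have hconst : ∀ b, 0 < b → ∫ u in Ioc 0 b, max (t - u) 0 ≤ b * t := by
      intro b hb
      have := setIntegral_mono_on (hci 0 b) (integrableOn_const (μ := volume) (C := t) (by simp))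
        measurableSet_Ioc fun u hu => hmax u hu.1
      simpa [hb.le] using this
    rcases le_total (t ^ 2) t with h | h
    · rw [min_eq_left h]
      have h1 : ∫ u in Ioc 0 R, max (t - u) 0 ≤ ∫ u in Ioc 0 t, max (t - u) 0 := by
        rw [← setIntegral_eq_of_subset_of_forall_sdiff_eq_zero measurableSet_Ioi
          (show Ioc 0 t ⊆ Ioi 0 from Ioc_subset_Ioi_self) (f := fun u => max (t - u) 0)]
        · refine setIntegral_mono_set ?_ (Eventually.of_forall fun u => le_max_right _ _)
            Ioc_subset_Ioi_self.eventuallyLE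
          rw [← Ioc_union_Ioi_eq_Ioi ht.le]
          refine (hci 0 t).union (integrableOn_zero.congr_fun (fun u hu => ?_) measurableSet_Ioi)
          rw [max_eq_right (by have : t < u := hu; linarith)]
        · intro u hu
          have : ¬ u ≤ t := fun h => hu.2 ⟨hu.1, h⟩
          rw [max_eq_right (by linarith)]
      have := hconst t ht
      nlinarith [sq_nonneg t]
    · rw [min_eq_right h]
      have := hconst R hR
      nlinarith
  have hI : Integrable (Function.uncurry fun u t : ℝ => max (t - u) 0 * n t)
      ((volume.restrict (Ioc 0 R)).prod (volume.restrict (Ioi 0))) := by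
    refine (integrable_prod_iff' hw.aestronglyMeasurable).2 ⟨Eventually.of_forall hslice, ?_⟩
    refine (hi.const_mul (1 + R)).mono' ?_ ?_
    · exact (hw.norm.aestronglyMeasurable (μ := (volume.restrict (Ioc 0 R)).prod
        (volume.restrict (Ioi 0)))).prod_swap.integral_prod_right'
    · filter_upwards [ae_restrict_mem measurableSet_Ioi] with t ht
      rw [Real.norm_of_nonneg (integral_nonneg fun u => norm_nonneg _)]
      simp only [Function.uncurry, norm_mul]
      rw [integral_mul_const, Real.norm_of_nonneg (hn0 t), ← mul_assoc]
      refine mul_le_mul_of_nonneg_right (le_trans (le_of_eq ?_) (hbd t ht)) (hn0 t)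
      refine integral_congr_ae (Eventually.of_forall fun u => ?_)
      exact Real.norm_of_nonneg (le_max_right _ _)
  have h : IntegrableOn (fun u => ∫ t in Ioi 0, max (t - u) 0 * n t) (Ioc 0 R) :=
    hI.integral_prod_left
  exact h.congr_fun (fun u hu => (tailKernel_eq hu.1.le).symm) measurableSet_Ioc

/-! ### Two-sided kernels -/

/-- Splitting `∫ k(y - x) g(y) dy` at `y = x`. -/
theorem integral_kernel_sub_mul {k g : ℝ → ℝ} {x : ℝ}
    (h : Integrable fun y => k (y - x) * g y) :
    IntegrableOn (fun u => k u * g (x + u)) (Ioi 0) ∧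
    IntegrableOn (fun u => k (-u) * g (x - u)) (Ioi 0) ∧
    ∫ y, k (y - x) * g y
      = (∫ u in Ioi 0, k (-u) * g (x - u)) + ∫ u in Ioi 0, k u * g (x + u) := by
  have h1 : Integrable fun u => k u * g (x + u) := by
    have := h.comp_add_right x
    refine this.congr (Eventually.of_forall fun u => ?_)
    dsimp only
    rw [add_sub_cancel_right, add_comm]
  have h2 : Integrable fun u => k (-u) * g (x - u) := by
    simpa only [sub_eq_add_neg] using h1.comp_neg
  refine ⟨h1.integrableOn, h2.integrableOn, ?_⟩
  have e1 : ∫ y, k (y - x) * g y = ∫ u, k u * g (x + u) := by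
    rw [← integral_add_right_eq_self _ x]
    simp only [add_comm _ x, add_sub_cancel_left]
  rw [e1, ← integral_add_compl measurableSet_Iic h1, compl_Iic]
  congr 1
  have := integral_comp_neg_Ioi 0 (fun u => k u * g (x + u))
  rw [neg_zero] at this
  rw [← this]
  simp only [sub_eq_add_neg]

end

/-! ### Half-line representation of the jumps -/

section

variable {n : ℝ → ℝ} {f : ℝ → ℝ} {M A γ : ℝ} {κ : ℝ → ℝ} {β : ℝ}

/-- The kernel `κ` on the right half-line represents the jumps with density `n` on the right
half-line: up to the drift `β`, the derivative of `x ↦ ∫_0^∞ κ(u) f'(x + u) du` is the integral of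
the compensated increments of `f`. -/
def RepresentsJumps (κ n : ℝ → ℝ) (β : ℝ) : Prop :=
  ∀ f M, C2Bounded f M → Tendsto f atTop (𝓝 0) →
    (∀ x, IntegrableOn (fun u => κ u * deriv f (x + u)) (Ioi 0)) →
    ∀ x, HasDerivAt (fun x => ∫ u in Ioi 0, κ u * deriv f (x + u))
      ((∫ t in Ioi 0, jump f (deriv f) x t * n t) + β * deriv f x) x

theorem RepresentsJumps.congr {κ' : ℝ → ℝ} (h : RepresentsJumps κ n β)
    (hκ : ∀ u, 0 < u → κ' u = κ u) : RepresentsJumps κ' n β := by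
  intro f M hf hlim hi x
  have e : ∀ x, ∀ u ∈ Ioi (0 : ℝ), κ' u * deriv f (x + u) = κ u * deriv f (x + u) :=
    fun x u hu => by rw [hκ u hu]
  have e' : ∀ x, ∫ u in Ioi 0, κ' u * deriv f (x + u) = ∫ u in Ioi 0, κ u * deriv f (x + u) :=
    fun x => setIntegral_congr_fun measurableSet_Ioi (e x)
  simp only [e']
  exact h f M hf hlim (fun x => (hi x).congr_fun (e x) measurableSet_Ioi) x

theorem measurable_jump (hf : C2Bounded f M) (x : ℝ) : Measurable (jump f (deriv f) x) := by
  have hc := hf.contDiff.continuous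
  unfold jump
  exact Measurable.sub (by fun_prop) (Measurable.indicator (by fun_prop) measurableSet_Icc)

theorem integrableOn_jump_mul (hn : Measurable n) (hn0 : ∀ y, 0 ≤ n y) (hf : C2Bounded f M)
    {b : ℝ → ℝ} (hb : ∀ t, 0 < t → levyWeight t ≤ b t)
    (hi : IntegrableOn (fun t => b t * n t) (Ioi 0)) (x : ℝ) :
    IntegrableOn (fun t => jump f (deriv f) x t * n t) (Ioi 0) :=
  integrableOn_mul_of_le measurableSet_Ioi hn hn0 (measurable_jump hf x) (4 * M)
    (fun t ht => (hf.norm_jump_le x t).trans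
      (mul_le_mul_of_nonneg_left (hb t ht) (by linarith [hf.nonneg]))) hi

theorem levyWeight_le_one (t : ℝ) : levyWeight t ≤ 1 := by
  unfold levyWeight
  rw [div_le_one (by positivity)]
  linarith

theorem levyWeight_le_sq (t : ℝ) : levyWeight t ≤ t ^ 2 := by
  unfold levyWeight
  exact div_le_self (sq_nonneg t) (by nlinarith [sq_nonneg t])

theorem levyWeight_le_self {t : ℝ} (ht : 0 < t) : levyWeight t ≤ t := by
  unfold levyWeight
  rw [div_le_iff₀ (by positivity)]
  nlinarith [sq_nonneg (t - 1), mul_pos ht ht, mul_nonneg ht.le (sq_nonneg (t - 1))]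

/-- The drift comes from the jumps larger than `1`, which `jump` does not compensate. -/
theorem representsJumps_tailKernel_add (hn : Measurable n) (hn0 : ∀ y, 0 ≤ n y)
    (hi : IntegrableOn (fun t => min (t ^ 2) t * n t) (Ioi 0)) (c : ℝ) :
    RepresentsJumps (fun u => tailKernel n u + c) n (-(∫ t in Ioi 1, t * n t) - c) := by
  intro f M hf hlim hk x
  refine (hasDerivAt_integral_tailKernel_add hn hn0 hi hf hlim c hk x).congr_deriv ?_
  have hJ := integrableOn_jump_mul hn hn0 hf
    (fun t ht => le_min (levyWeight_le_sq t) (levyWeight_le_self ht)) hi x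
  have hI : IntegrableOn (fun t => t * n t) (Ioi 1) := by
    refine (hi.mono_set (Ioi_subset_Ioi zero_le_one)).congr_fun (fun t ht => ?_) measurableSet_Ioi
    have : 1 < t := ht
    dsimp only
    rw [min_eq_right (by nlinarith)]
  have hI' : IntegrableOn ((Ioi 1).indicator fun t => t * n t) (Ioi 0) :=
    ((integrable_indicator_iff measurableSet_Ioi).2 hI).integrableOn
  have e : ∫ t in Ioi 0, (f (x + t) - f x - t * deriv f x) * n t
      = ∫ t in Ioi 0, (jump f (deriv f) x t * n t
        - deriv f x * (Ioi 1).indicator (fun t => t * n t) t) := by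
    refine setIntegral_congr_fun measurableSet_Ioi fun t ht => ?_
    have ht : 0 < t := ht
    dsimp only [jump]
    by_cases h : t ≤ 1
    · rw [indicator_of_mem (show t ∈ Icc (-1 : ℝ) 1 from ⟨by linarith, h⟩),
        indicator_of_notMem (show t ∉ Ioi (1 : ℝ) from not_lt.2 h), smul_eq_mul]
      ring
    · rw [indicator_of_notMem (show t ∉ Icc (-1 : ℝ) 1 from fun h' => h h'.2),
        indicator_of_mem (show t ∈ Ioi (1 : ℝ) from not_le.1 h)]
      ring
  rw [e, integral_sub hJ (hI'.const_mul _), integral_const_mul,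
    setIntegral_indicator measurableSet_Ioi,
    inter_eq_self_of_subset_right (Ioi_subset_Ioi zero_le_one)]
  ring

/-- The drift comes from the jumps of size at most `1`, which `jump` compensates. -/
theorem representsJumps_const_sub_minKernel (hn : Measurable n) (hn0 : ∀ y, 0 ≤ n y)
    (hi : IntegrableOn (fun t => min t 1 * n t) (Ioi 0)) (c : ℝ) :
    RepresentsJumps (fun u => c - minKernel n u) n ((∫ t in Ioc 0 1, t * n t) - c) := by
  intro f M hf hlim hk x
  refine (hasDerivAt_integral_const_sub_minKernel hn hn0 hi hf hlim c hk x).congr_deriv ?_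
  have hJ := integrableOn_jump_mul hn hn0 hf
    (fun t ht => le_min (levyWeight_le_self ht) (levyWeight_le_one t)) hi x
  have hI : IntegrableOn (fun t => t * n t) (Ioc 0 1) := by
    refine (hi.mono_set Ioc_subset_Ioi_self).congr_fun (fun t ht => ?_) measurableSet_Ioc
    dsimp only
    rw [min_eq_left ht.2]
  have hI' : IntegrableOn ((Ioc 0 1).indicator fun t => t * n t) (Ioi 0) :=
    ((integrable_indicator_iff measurableSet_Ioc).2 hI).integrableOn
  have e : ∫ t in Ioi 0, (f (x + t) - f x) * n t
      = ∫ t in Ioi 0, (jump f (deriv f) x t * n t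
        + deriv f x * (Ioc 0 1).indicator (fun t => t * n t) t) := by
    refine setIntegral_congr_fun measurableSet_Ioi fun t ht => ?_
    have ht : 0 < t := ht
    dsimp only [jump]
    by_cases h : t ≤ 1
    · rw [indicator_of_mem (show t ∈ Icc (-1 : ℝ) 1 from ⟨by linarith, h⟩),
        indicator_of_mem (show t ∈ Ioc (0 : ℝ) 1 from ⟨ht, h⟩), smul_eq_mul]
      ring
    · rw [indicator_of_notMem (show t ∉ Icc (-1 : ℝ) 1 from fun h' => h h'.2),
        indicator_of_notMem (show t ∉ Ioc (0 : ℝ) 1 from fun h' => h h'.2)]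
      ring
  rw [e, integral_add hJ (hI'.const_mul _), integral_const_mul,
    setIntegral_indicator measurableSet_Ioc,
    inter_eq_self_of_subset_right Ioc_subset_Ioi_self]
  ring

/-! ### Gluing the two half-lines -/

theorem C2Bounded.comp_neg (hf : C2Bounded f M) : C2Bounded (fun x => f (-x)) M := by
  refine .of_hasDerivAt (f' := fun x => -deriv f (-x)) (f'' := fun x => deriv (deriv f) (-x))
    (fun x => ?_) (fun x => ?_)
    ((continuous_deriv_deriv_of_contDiff_two hf.contDiff).comp continuous_neg)
    (fun x => hf.bound _) (fun x => by rw [abs_neg]; exact hf.bound_deriv _)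
    (fun x => hf.bound_deriv2 _)
  · exact ((hasDerivAt_of_contDiff_two hf.contDiff (-x)).scomp x (hasDerivAt_neg x)).congr_deriv
      (by simp)
  · exact ((hasDerivAt_deriv_of_contDiff_two hf.contDiff (-x)).scomp x
      (hasDerivAt_neg x)).neg.congr_deriv (by simp)

theorem jump_comp_neg (f : ℝ → ℝ) (x t : ℝ) :
    jump (fun x => f (-x)) (deriv fun x => f (-x)) (-x) t = jump f (deriv f) x (-t) := by
  unfold jump
  dsimp only
  rw [deriv_comp_neg, neg_neg, neg_add, neg_neg]
  by_cases h : t ∈ Icc (-1 : ℝ) 1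
  · rw [indicator_of_mem h,
      indicator_of_mem (show -t ∈ Icc (-1 : ℝ) 1 from ⟨by linarith [h.2], by linarith [h.1]⟩)]
    simp
  · rw [indicator_of_notMem h, indicator_of_notMem (show -t ∉ Icc (-1 : ℝ) 1 from
      fun h' => h ⟨by linarith [h'.2], by linarith [h'.1]⟩)]

/-- The left half-line is the right half-line of the reflected function `x ↦ f (-x)`, whose
derivative has the opposite sign; hence the difference of the drifts. -/
theorem hasDerivAt_convOp {k : ℝ → ℝ} {βr βl : ℝ} (hr : RepresentsJumps k n βr)
    (hl : RepresentsJumps (fun u => k (-u)) (fun t => n (-t)) βl) (hf : C2Bounded f M)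
    (htop : Tendsto f atTop (𝓝 0)) (hbot : Tendsto f atBot (𝓝 0))
    (hk : ConvConverges k (deriv f)) (x : ℝ)
    (hJ : Integrable fun t => jump f (deriv f) x t * n t) :
    HasDerivAt (convOp A k (deriv f)) (1 / 2 * A * deriv (deriv f) x + (βr - βl) * deriv f x
      + ∫ t, jump f (deriv f) x t * n t) x := by
  have hneg : ∀ x u, deriv (fun x => f (-x)) (-x + u) = -deriv f (x - u) := by
    intro x u
    rw [deriv_comp_neg, neg_add, neg_neg, sub_eq_add_neg]
  have h1 := hr f M hf htop (fun x => (integral_kernel_sub_mul (hk x)).1) x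
  have h2 := hl _ M hf.comp_neg (hbot.comp tendsto_neg_atTop_atBot) (fun x => by
    have := (integral_kernel_sub_mul (hk (-x))).2.1.neg
    refine this.congr (Eventually.of_forall fun u => ?_)
    have e := hneg (-x) u
    rw [neg_neg] at e
    simp only [e, Pi.neg_apply, mul_neg]) (-x)
  have h3 : HasDerivAt (fun x => ∫ u in Ioi 0, k (-u) * deriv f (x - u))
      ((∫ t in Ioi 0, jump f (deriv f) x (-t) * n (-t)) - βl * deriv f x) x := by
    have h4 := (h2.scomp x (hasDerivAt_neg x)).neg
    refine (h4.congr_of_eventuallyEq (Eventually.of_forall fun x => ?_)).congr_deriv ?_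
    · simp only [Pi.neg_apply, Function.comp, hneg, mul_neg, integral_neg, neg_neg]
    · simp only [jump_comp_neg]
      rw [deriv_comp_neg, neg_neg]
      simp only [smul_eq_mul]
      ring
  have e1 : convOp A k (deriv f) = fun x => 1 / 2 * A * deriv f x +
      ((∫ u in Ioi 0, k (-u) * deriv f (x - u)) + ∫ u in Ioi 0, k u * deriv f (x + u)) :=
    funext fun x => by
      unfold convOp
      rw [(integral_kernel_sub_mul (hk x)).2.2]
  rw [e1]
  refine (((hasDerivAt_deriv_of_contDiff_two hf.contDiff x).const_mul (1 / 2 * A)).add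
    (h3.add h1)).congr_deriv ?_
  have e2 := integral_comp_neg_Ioi 0 (fun t => jump f (deriv f) x t * n t)
  rw [neg_zero] at e2
  rw [← integral_add_compl measurableSet_Iic hJ, compl_Iic, ← e2]
  ring

theorem integrableOn_Icc_of_halves {k : ℝ → ℝ} {R : ℝ} (hR : 0 < R)
    (hr : IntegrableOn k (Ioc 0 R)) (hl : IntegrableOn (fun u => k (-u)) (Ioc 0 R)) :
    IntegrableOn k (Icc (-R) R) := by
  have h1 : IntegrableOn k (Ico (-R) 0) := by
    have := (Measure.measurePreserving_neg (volume : Measure ℝ)).integrableOn_comp_preimage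
      (Homeomorph.neg ℝ).measurableEmbedding (f := k) (s := Ico (-R) 0)
    refine this.1 (hl.congr_set_ae (ae_of_all _ fun u => ?_))
    simp only [eq_iff_iff]
    change (u ∈ Neg.neg ⁻¹' Ico (-R) 0) ↔ u ∈ Ioc 0 R
    simp only [mem_preimage, mem_Ico, mem_Ioc]
    constructor <;> rintro ⟨a, b⟩ <;> constructor <;> linarith
  have h2 : IntegrableOn k (Icc 0 R) := (integrableOn_Icc_iff_integrableOn_Ioc).2 hr
  rw [← Ico_union_Icc_eq_Icc (by linarith : -R ≤ 0) hR.le]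
  exact h1.union h2

/-- Kernels that represent the jumps on both half-lines, with drifts that differ by `γ`, give the
convolution form of the generator. -/
theorem hasConvolutionForm_of_representsJumps {Ω : Type*} [MeasurableSpace Ω] {P : Measure Ω}
    [IsProbabilityMeasure P] {X : ℝ≥0 → Ω → ℝ} (hX : ∀ t, Measurable (X t))
    (hn : Measurable n) (hn0 : ∀ y, 0 ≤ n y)
    (hT : HasLevyTriplet P X A γ (volume.withDensity fun y => ENNReal.ofReal (n y)))
    {k : ℝ → ℝ} {βr βl : ℝ} (hr : RepresentsJumps k n βr)
    (hl : RepresentsJumps (fun u => k (-u)) (fun t => n (-t)) βl) (hβ : βr - βl = γ)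
    (hkr : ∀ R, 0 < R → IntegrableOn k (Ioc 0 R))
    (hkl : ∀ R, 0 < R → IntegrableOn (fun u => k (-u)) (Ioc 0 R)) :
    HasConvolutionForm (generator (transitionOp P X)) A k where
  locallyIntegrable R hR := integrableOn_Icc_of_halves hR (hkr R hR) (hkl R hR)
  converges f hf hc x := by
    have hcont := (contDiff_deriv_of_contDiff_two hf.1).continuous
    have hk : LocallyIntegrable k := by
      refine locallyIntegrable_iff.2 fun K hK => ?_
      obtain ⟨R, hR0, hR⟩ := hK.isBounded.subset_closedBall_lt 0 0
      rw [Real.closedBall_eq_Icc, zero_sub, zero_add] at hR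
      exact (integrableOn_Icc_of_halves hR0 (hkr R hR0) (hkl R hR0)).mono_set hR
    have h1 : Integrable fun u => k u * deriv f (u + x) := by
      have hc' : HasCompactSupport fun u => deriv f (u + x) :=
        hc.deriv.comp_homeomorph (Homeomorph.addRight x)
      have hcont' : Continuous fun u => deriv f (u + x) := by fun_prop
      simpa only [smul_eq_mul] using hk.integrable_smul_right_of_hasCompactSupport hcont' hc'
    simpa using h1.comp_sub_right x
  representation f hf := by
    obtain ⟨M, hM⟩ := exists_c2Bounded_of_tendsto hf
    obtain ⟨hd, hL⟩ := exists_mem_domain_generator hX hT f hf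
    refine ⟨hd, fun hk x => ?_⟩
    have h0 := hf.2 0 (by norm_num)
    rw [iteratedDeriv_zero, cocompact_eq_atBot_atTop] at h0
    have hm : Measurable fun y => ENNReal.ofReal (n y) := hn.ennreal_ofReal
    have hlt : ∀ᵐ y : ℝ, ENNReal.ofReal (n y) < ∞ := Eventually.of_forall fun y =>
      ENNReal.ofReal_lt_top
    have e : ∀ t, (ENNReal.ofReal (n t)).toReal • jump f (deriv f) x t
        = jump f (deriv f) x t * n t := fun t => by
      rw [ENNReal.toReal_ofReal (hn0 t), smul_eq_mul, mul_comm]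
    have hJ := (integrable_withDensity_iff_integrable_smul' hm hlt).1
      (hM.integrable_jump hT.levyMeasure x)
    simp only [e] at hJ
    have hJe := integral_withDensity_eq_integral_toReal_smul hm hlt (jump f (deriv f) x)
    simp only [e] at hJe
    rw [hL, levyOp, hJe, ← hβ]
    exact hasDerivAt_convOp hr hl hM (h0.mono_left le_sup_right) (h0.mono_left le_sup_left) hk x hJ

end

section

variable {n : ℝ → ℝ} {A γ C α : ℝ}

/-! ### Moments of the Lévy density -/

/-- If `n(t) ≤ C t ^ (-α - 1)` on the right half-line, then the moments of order `p > α` are finite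
near `0`, and those of order `q < α` are finite near infinity. -/
theorem integrableOn_mul_of_le_rpow (hn : Measurable n) (hn0 : ∀ y, 0 ≤ n y)
    (hb : ∀ t, 0 < t → n t ≤ C * t ^ (-α - 1)) {p q : ℕ} (hp : α < p) (hq : q < α) :
    IntegrableOn (fun t => t ^ p * n t) (Ioc 0 1) ∧
      IntegrableOn (fun t => t ^ q * n t) (Ioi 1) := by
  have hbd : ∀ (p : ℕ) (t : ℝ), 0 < t → ‖t ^ p * n t‖ ≤ C * t ^ ((p : ℝ) - α - 1) := by
    intro p t ht
    rw [Real.norm_of_nonneg (mul_nonneg (pow_nonneg ht.le p) (hn0 t))]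
    have h1 : t ^ ((p : ℝ) - α - 1) = t ^ p * t ^ (-α - 1) := by
      rw [← Real.rpow_natCast, ← Real.rpow_add ht]
      congr 1
      ring
    rw [h1]
    have := mul_le_mul_of_nonneg_left (hb t ht) (pow_nonneg ht.le p)
    linarith
  constructor
  · have h1 : IntegrableOn (fun t : ℝ => t ^ ((p : ℝ) - α - 1)) (Ioc 0 1) :=
      (intervalIntegrable_iff_integrableOn_Ioc_of_le zero_le_one).1
        (intervalIntegral.intervalIntegrable_rpow' (by linarith))
    refine (h1.const_mul C).mono' (by fun_prop) ?_
    filter_upwards [ae_restrict_mem measurableSet_Ioc] with t ht using hbd p t ht.1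
  · have h1 : IntegrableOn (fun t : ℝ => t ^ ((q : ℝ) - α - 1)) (Ioi 1) :=
      integrableOn_Ioi_rpow_of_lt (by linarith) one_pos
    refine (h1.const_mul C).mono' (by fun_prop) ?_
    filter_upwards [ae_restrict_mem measurableSet_Ioi] with t ht using
      hbd q t (one_pos.trans ht)

theorem integrableOn_min_sq_self_mul (hn : Measurable n) (hn0 : ∀ y, 0 ≤ n y)
    (hb : ∀ t, 0 < t → n t ≤ C * t ^ (-α - 1)) (hα : 1 < α) (hα2 : α < 2) :
    IntegrableOn (fun t => min (t ^ 2) t * n t) (Ioi 0) := by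
  obtain ⟨h1, h2⟩ := integrableOn_mul_of_le_rpow hn hn0 hb (p := 2) (q := 1)
    (by exact_mod_cast hα2) (by exact_mod_cast hα)
  rw [← Ioc_union_Ioi_eq_Ioi (zero_le_one' ℝ)]
  refine (h1.congr_fun (fun t ht => ?_) measurableSet_Ioc).union
    (h2.congr_fun (fun t ht => ?_) measurableSet_Ioi)
  · rw [min_eq_left (by nlinarith [ht.1, ht.2])]
  · have ht : 1 < t := ht
    dsimp only
    rw [min_eq_right (by nlinarith), pow_one]

theorem integrableOn_min_self_one_mul (hn : Measurable n) (hn0 : ∀ y, 0 ≤ n y)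
    (hb : ∀ t, 0 < t → n t ≤ C * t ^ (-α - 1)) (hα0 : 0 < α) (hα : α < 1) :
    IntegrableOn (fun t => min t 1 * n t) (Ioi 0) := by
  obtain ⟨h1, h2⟩ := integrableOn_mul_of_le_rpow hn hn0 hb (p := 1) (q := 0)
    (by exact_mod_cast hα) (by exact_mod_cast hα0)
  rw [← Ioc_union_Ioi_eq_Ioi (zero_le_one' ℝ)]
  refine (h1.congr_fun (fun t ht => ?_) measurableSet_Ioc).union
    (h2.congr_fun (fun t ht => ?_) measurableSet_Ioi)
  · rw [min_eq_left ht.2, pow_one]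
  · have ht : 1 < t := ht
    dsimp only
    rw [min_eq_right ht.le, pow_zero]

/-! ### The kernels on the half-lines -/

theorem p0_of_pos {u : ℝ} (hu : 0 < u) : p0 u = -(1 / 2) := by
  simp [p0, Real.sign_of_pos hu]

theorem p0_neg_of_pos {u : ℝ} (hu : 0 < u) : p0 (-u) = 1 / 2 := by
  simp [p0, Real.sign_of_neg (neg_lt_zero.2 hu)]

theorem k0High_of_pos {u : ℝ} (hu : 0 < u) : k0High n u = tailKernel n u := by
  simp [k0High, hu, hu.not_gt, tailKernel]

theorem integral_Iio_neg (g : ℝ → ℝ) (u : ℝ) :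
    ∫ t in Iio (-u), g t = ∫ t in Ioi u, g (-t) := by
  rw [integral_comp_neg_Ioi, integral_Iic_eq_integral_Iio]

theorem k0High_neg_of_pos {u : ℝ} (hu : 0 < u) :
    k0High n (-u) = k0High (fun t => n (-t)) u := by
  rw [k0High_of_pos hu, tailKernel, k0High, if_pos (neg_lt_zero.2 hu),
    if_neg (by linarith), add_zero, integral_Iio_neg]
  refine integral_congr_ae (Eventually.of_forall fun t => ?_)
  dsimp only
  ring

theorem k0High_neg (n : ℝ → ℝ) (u : ℝ) : k0High n (-u) = k0High (fun t => n (-t)) u := by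
  rcases lt_trichotomy u 0 with h | rfl | h
  · have := k0High_neg_of_pos (n := fun t => n (-t)) (neg_pos.2 h)
    simp only [neg_neg] at this
    exact this.symm
  · simp [k0High]
  · exact k0High_neg_of_pos h

theorem k0Low_of_pos (hn : Measurable n) (hn0 : ∀ y, 0 ≤ n y)
    (hi : IntegrableOn (fun t => min t 1 * n t) (Ioi 0)) {u : ℝ} (hu : 0 < u) :
    k0Low n u = -minKernel n u := by
  have h1 := integrableOn_min_mul hn hn0 hi hu.le
  have e : minKernel n u = (∫ t in Ioc 0 u, t * n t) + u * ∫ t in Ioi u, n t := by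
    rw [minKernel, ← Ioc_union_Ioi_eq_Ioi hu.le, setIntegral_union
      Ioc_disjoint_Ioi_same measurableSet_Ioi
      (h1.mono_set Ioc_subset_Ioi_self) (h1.mono_set (Ioi_subset_Ioi hu.le)),
      ← integral_const_mul]
    congr 1
    · exact setIntegral_congr_fun measurableSet_Ioc fun t ht => by rw [min_eq_left ht.2]
    · exact setIntegral_congr_fun measurableSet_Ioi fun t ht => by
        rw [min_eq_right (le_of_lt ht)]
  rw [e, k0Low, if_neg hu.not_gt, if_pos hu, integral_Ioc_eq_integral_Ioo]
  ring

theorem k0Low_neg_of_pos {u : ℝ} (hu : 0 < u) :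
    k0Low n (-u) = k0Low (fun t => n (-t)) u := by
  have h : ∫ t in Ioo (-u) 0, t * n t = -∫ t in Ioo 0 u, t * n (-t) := by
    rw [← integral_Ioc_eq_integral_Ioo, ← integral_Ioc_eq_integral_Ioo,
      ← intervalIntegral.integral_of_le (neg_nonpos.2 hu.le),
      ← intervalIntegral.integral_of_le hu.le, ← intervalIntegral.integral_neg]
    have := intervalIntegral.integral_comp_neg (a := 0) (b := u) fun t => t * n t
    rw [neg_zero] at this
    rw [← this]
    simp only [neg_mul]
  rw [k0Low, k0Low, if_pos (neg_lt_zero.2 hu), if_neg (by linarith), if_neg hu.not_gt, if_pos hu,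
    integral_Iio_neg, h]
  ring

/-- The integrand `max (t - u) 0 n(t)` is Lipschitz in `u` with constant `n(t)`, which is
integrable away from `0`, and differentiable at `u = 1` for `t ≠ 1`. -/
theorem hasDerivAt_tailKernel_one (hn : Measurable n) (hn0 : ∀ y, 0 ≤ n y)
    (hi : IntegrableOn (fun t => min (t ^ 2) t * n t) (Ioi 0)) :
    HasDerivAt (tailKernel n) (-∫ t in Ioi 1, n t) 1 := by
  have hnI : IntegrableOn n (Ioi (1 / 2)) := by
    have h := integrableOn_mul_of_le (a := fun _ => 1) measurableSet_Ioi hn hn0 (by fun_prop) 4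
      ?_ (hi.mono_set (Ioi_subset_Ioi (by norm_num : (0 : ℝ) ≤ 1 / 2)))
    · simpa using h
    · intro t ht
      have ht : 1 / 2 < t := ht
      have : 1 / 4 ≤ min (t ^ 2) t := le_min (by nlinarith) (by linarith)
      rw [abs_one]
      linarith
  have hF : IntegrableOn (fun t => max (t - 1) 0 * n t) (Ioi (1 / 2)) :=
    (integrableOn_max_sub_mul hn hn0 hi one_pos).mono_set (Ioi_subset_Ioi (by norm_num))
  have h := (hasDerivAt_integral_of_dominated_loc_of_lip (μ := volume.restrict (Ioi (1 / 2)))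
    (F := fun u t => max (t - u) 0 * n t) (F' := fun t => -(Ioi 1).indicator n t) (bound := n)
    (x₀ := (1 : ℝ)) (s := univ) univ_mem (Eventually.of_forall fun u => by fun_prop) hF
    (hn.indicator measurableSet_Ioi).neg.aestronglyMeasurable
    (Eventually.of_forall fun t => ?_) hnI ?_).2
  · rw [integral_neg, setIntegral_indicator measurableSet_Ioi,
      inter_eq_self_of_subset_right (Ioi_subset_Ioi (by norm_num))] at h
    refine h.congr_of_eventuallyEq ?_
    filter_upwards [Ioi_mem_nhds (by norm_num : (1 / 2 : ℝ) < 1)] with u hu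
    exact tailKernel_eq (le_of_lt hu)
  · refine LipschitzOnWith.of_dist_le_mul fun u _ v _ => ?_
    rw [Real.dist_eq, Real.dist_eq, ← sub_mul, abs_mul, abs_of_nonneg (hn0 t), Real.coe_nnabs,
      abs_of_nonneg (hn0 t), mul_comm]
    refine mul_le_mul_of_nonneg_left ?_ (hn0 t)
    have := abs_max_sub_max_le_abs (t - u) (t - v) 0
    rwa [sub_sub_sub_cancel_left, abs_sub_comm v] at this
  · have hne : ∀ᵐ t ∂(volume.restrict (Ioi (1 / 2 : ℝ))), t ≠ 1 :=
      ae_restrict_of_ae (Measure.ae_ne volume 1)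
    filter_upwards [hne] with t ht
    rcases lt_or_gt_of_ne ht with h | h
    · rw [indicator_of_notMem (show t ∉ Ioi (1 : ℝ) from not_lt.2 h.le), neg_zero]
      refine (hasDerivAt_const (1 : ℝ) (0 : ℝ)).congr_of_eventuallyEq ?_
      filter_upwards [Ioi_mem_nhds h] with u hu
      have hu : t < u := hu
      rw [max_eq_right (by linarith), zero_mul]
    · rw [indicator_of_mem (show t ∈ Ioi (1 : ℝ) from h)]
      have hd := ((hasDerivAt_id (1 : ℝ)).const_sub t).mul_const (n t)
      rw [neg_one_mul] at hd
      refine hd.congr_of_eventuallyEq ?_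
      filter_upwards [Iio_mem_nhds h] with u hu
      have hu : u < t := hu
      rw [max_eq_left (by linarith), id]

theorem k0High_one_sub_deriv (hn : Measurable n) (hn0 : ∀ y, 0 ≤ n y)
    (hi : IntegrableOn (fun t => min (t ^ 2) t * n t) (Ioi 0)) :
    k0High n 1 - deriv (k0High n) 1 = ∫ t in Ioi 1, t * n t := by
  have hd : deriv (k0High n) 1 = -∫ t in Ioi 1, n t := by
    refine ((hasDerivAt_tailKernel_one hn hn0 hi).congr_of_eventuallyEq ?_).deriv
    filter_upwards [Ioi_mem_nhds (zero_lt_one' ℝ)] with u hu using k0High_of_pos hu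
  have hI : IntegrableOn (fun t => (t - 1) * n t) (Ioi 1) := by
    refine ((integrableOn_max_sub_mul hn hn0 hi one_pos).mono_set
      (Ioi_subset_Ioi zero_le_one)).congr_fun (fun t ht => ?_) measurableSet_Ioi
    have ht : 1 < t := ht
    dsimp only
    rw [max_eq_left (by linarith)]
  have hnI : IntegrableOn n (Ioi 1) := by
    have h := integrableOn_mul_of_le (a := fun _ => 1) measurableSet_Ioi hn hn0 (by fun_prop) 1
      ?_ (hi.mono_set (Ioi_subset_Ioi zero_le_one))
    · simpa using h
    · intro t ht
      have ht : 1 < t := ht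
      rw [abs_one, one_mul]
      exact le_min (by nlinarith) ht.le
  rw [hd, k0High_of_pos one_pos, tailKernel, sub_neg_eq_add, ← integral_add hI hnI]
  refine integral_congr_ae (Eventually.of_forall fun t => ?_)
  dsimp only
  ring

/-- `Γ = -∫_{|t| > 1} t n(t) dt`, the change of drift between compensating small jumps only and
compensating all jumps. -/
theorem bigGamma_eq (hn : Measurable n) (hn0 : ∀ y, 0 ≤ n y)
    (hi : IntegrableOn (fun t => min (t ^ 2) t * n t) (Ioi 0))
    (hi' : IntegrableOn (fun t => min (t ^ 2) t * n (-t)) (Ioi 0)) :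
    bigGamma n = (∫ t in Ioi 1, t * n (-t)) - ∫ t in Ioi 1, t * n t := by
  have hd : deriv (k0High n) (-1) = -deriv (k0High fun t => n (-t)) 1 := by
    have e : k0High n = fun u => k0High (fun t => n (-t)) (-u) := funext fun u => by
      rw [← k0High_neg, neg_neg]
    rw [e, deriv_comp_neg, neg_neg]
  rw [bigGamma, hd, k0High_neg, ← k0High_one_sub_deriv hn hn0 hi,
    ← k0High_one_sub_deriv (n := fun t => n (-t)) (hn.comp measurable_neg)
      (fun t => hn0 _) hi']
  ring

theorem drift_eq (hi : IntegrableOn (fun t => min t 1 * n t) (Ioi 0))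
    (hi' : IntegrableOn (fun t => min t 1 * n (-t)) (Ioi 0)) :
    drift γ n = γ - ((∫ t in Ioc 0 1, t * n t) - ∫ t in Ioc 0 1, t * n (-t)) := by
  have key : ∀ m : ℝ → ℝ, IntegrableOn (fun t => min t 1 * m t) (Ioi 0) →
      IntegrableOn (fun t => t * m t) (Ioc 0 1) := fun m hm =>
    (hm.mono_set Ioc_subset_Ioi_self).congr_fun (fun t ht => by
      dsimp only; rw [min_eq_left ht.2]) measurableSet_Ioc
  have hI : IntegrableOn (fun t => t * n t) (Icc (-1) 1) := by
    refine integrableOn_Icc_of_halves one_pos (key n hi) ?_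
    exact (key _ hi').neg.congr_fun (fun t _ => (neg_mul _ _).symm) measurableSet_Ioc
  have hI1 : IntervalIntegrable (fun t => t * n t) volume (-1) 0 :=
    (intervalIntegrable_iff_integrableOn_Icc_of_le (by norm_num)).2
      (hI.mono_set (Icc_subset_Icc le_rfl zero_le_one))
  have hI2 : IntervalIntegrable (fun t => t * n t) volume 0 1 :=
    (intervalIntegrable_iff_integrableOn_Icc_of_le (by norm_num)).2
      (hI.mono_set (Icc_subset_Icc (by norm_num) le_rfl))
  have h := intervalIntegral.integral_comp_neg (a := 0) (b := 1) fun t => t * n t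
  rw [neg_zero] at h
  rw [drift, integral_Icc_eq_integral_Ioc, ← intervalIntegral.integral_of_le (by norm_num),
    ← intervalIntegral.integral_add_adjacent_intervals hI1 hI2, ← h,
    ← intervalIntegral.integral_of_le zero_le_one, ← intervalIntegral.integral_of_le zero_le_one]
  simp only [neg_mul, intervalIntegral.integral_neg]
  ring

theorem le_rpow_of_bound (hbound : ∀ y, y ≠ 0 → n y ≤ C * |y| ^ (-α - 1)) :
    (∀ t, 0 < t → n t ≤ C * t ^ (-α - 1)) ∧ ∀ t, 0 < t → n (-t) ≤ C * t ^ (-α - 1) :=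
  ⟨fun t ht => by simpa [abs_of_pos ht] using hbound t ht.ne',
    fun t ht => by simpa [abs_of_pos ht] using hbound (-t) (neg_ne_zero.2 ht.ne')⟩

theorem hasConvolutionForm_k0High {Ω : Type*} [MeasurableSpace Ω] {P : Measure Ω}
    [IsProbabilityMeasure P] {X : ℝ≥0 → Ω → ℝ} (hX : ∀ t, Measurable (X t)) (hn : Measurable n)
    (hn0 : ∀ y, 0 ≤ n y)
    (hT : HasLevyTriplet P X A γ (volume.withDensity fun y => ENNReal.ofReal (n y)))
    (hα : 1 < α) (hα2 : α < 2) (hbound : ∀ y, y ≠ 0 → n y ≤ C * |y| ^ (-α - 1)) :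
    HasConvolutionForm (generator (transitionOp P X)) A
      (fun y => k0High n y + (γ - bigGamma n) * p0 y) := by
  obtain ⟨hbr, hbl⟩ := le_rpow_of_bound hbound
  have hn' : Measurable fun t => n (-t) := hn.comp measurable_neg
  have hn0' : ∀ t, 0 ≤ n (-t) := fun t => hn0 _
  have hi := integrableOn_min_sq_self_mul hn hn0 hbr hα hα2
  have hi' := integrableOn_min_sq_self_mul hn' hn0' hbl hα hα2
  set c := γ - bigGamma n with hc
  have er : ∀ u, 0 < u → k0High n u + c * p0 u = tailKernel n u + -c / 2 := fun u hu => by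
    rw [k0High_of_pos hu, p0_of_pos hu]
    ring
  have el : ∀ u, 0 < u → k0High n (-u) + c * p0 (-u)
      = tailKernel (fun t => n (-t)) u + c / 2 := fun u hu => by
    rw [k0High_neg, k0High_of_pos hu, p0_neg_of_pos hu]
    ring
  refine hasConvolutionForm_of_representsJumps hX hn hn0 hT
    ((representsJumps_tailKernel_add hn hn0 hi _).congr er)
    ((representsJumps_tailKernel_add hn' hn0' hi' _).congr el) ?_ (fun R hR => ?_)
    (fun R hR => ?_)
  · rw [hc, bigGamma_eq hn hn0 hi hi']
    ring
  · exact ((integrableOn_tailKernel hn hn0 hi hR).add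
      (integrableOn_const (by simp))).congr_fun (fun u hu => (er u hu.1).symm) measurableSet_Ioc
  · exact ((integrableOn_tailKernel hn' hn0' hi' hR).add
      (integrableOn_const (by simp))).congr_fun (fun u hu => (el u hu.1).symm) measurableSet_Ioc

theorem hasConvolutionForm_k0Low {Ω : Type*} [MeasurableSpace Ω] {P : Measure Ω}
    [IsProbabilityMeasure P] {X : ℝ≥0 → Ω → ℝ} (hX : ∀ t, Measurable (X t)) (hn : Measurable n)
    (hn0 : ∀ y, 0 ≤ n y)
    (hT : HasLevyTriplet P X A γ (volume.withDensity fun y => ENNReal.ofReal (n y)))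
    (hα0 : 0 < α) (hα : α < 1) (hbound : ∀ y, y ≠ 0 → n y ≤ C * |y| ^ (-α - 1)) :
    HasConvolutionForm (generator (transitionOp P X)) A
      (fun y => k0Low n y + drift γ n * p0 y) := by
  obtain ⟨hbr, hbl⟩ := le_rpow_of_bound hbound
  have hn' : Measurable fun t => n (-t) := hn.comp measurable_neg
  have hn0' : ∀ t, 0 ≤ n (-t) := fun t => hn0 _
  have hi := integrableOn_min_self_one_mul hn hn0 hbr hα0 hα
  have hi' := integrableOn_min_self_one_mul hn' hn0' hbl hα0 hα
  set c := drift γ n with hc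
  have er : ∀ u, 0 < u → k0Low n u + c * p0 u = -c / 2 - minKernel n u := fun u hu => by
    rw [k0Low_of_pos hn hn0 hi hu, p0_of_pos hu]
    ring
  have el : ∀ u, 0 < u → k0Low n (-u) + c * p0 (-u)
      = c / 2 - minKernel (fun t => n (-t)) u := fun u hu => by
    rw [k0Low_neg_of_pos hu, k0Low_of_pos hn' hn0' hi' hu, p0_neg_of_pos hu]
    ring
  refine hasConvolutionForm_of_representsJumps hX hn hn0 hT
    ((representsJumps_const_sub_minKernel hn hn0 hi _).congr er)
    ((representsJumps_const_sub_minKernel hn' hn0' hi' _).congr el) ?_ (fun R hR => ?_)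
    (fun R hR => ?_)
  · rw [hc, drift_eq hi hi']
    ring
  · exact ((integrableOn_const (by simp)).sub
      (integrableOn_minKernel hn hn0 hi R)).congr_fun (fun u hu => (er u hu.1).symm)
        measurableSet_Ioc
  · exact ((integrableOn_const (by simp)).sub
      (integrableOn_minKernel hn' hn0' hi' R)).congr_fun (fun u hu => (el u hu.1).symm)
        measurableSet_Ioc

end

end LevyConv

end

theorem proposition2p1 {Ω : Type*} [MeasurableSpace Ω] (P : MeasureTheory.Measure Ω)
    [MeasureTheory.IsProbabilityMeasure P] (X : ℝ≥0 → Ω → ℝ)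
    (hX : LevyConv.IsLevyProcess P X)
    (A γ : ℝ) (n : ℝ → ℝ) (hn : Measurable n) (hn0 : ∀ y, 0 ≤ n y)
    (hT : LevyConv.HasLevyTriplet P X A γ
      (MeasureTheory.volume.withDensity fun y => ENNReal.ofReal (n y)))
    (C α : ℝ) (hC : 0 < C) (hα0 : 0 < α) (hα2 : α < 2) (hα1 : α ≠ 1)
    (hbound : ∀ y, y ≠ 0 → n y ≤ C * |y| ^ (-α - 1)) :
    (1 < α → LevyConv.HasConvolutionForm (LevyConv.generator (LevyConv.transitionOp P X)) A
      (fun y => LevyConv.k0High n y + (γ - LevyConv.bigGamma n) * LevyConv.p0 y)) ∧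
    (α < 1 → LevyConv.HasConvolutionForm (LevyConv.generator (LevyConv.transitionOp P X)) A
      (fun y => LevyConv.k0Low n y + LevyConv.drift γ n * LevyConv.p0 y)) := by
  exact ⟨fun hα => LevyConv.hasConvolutionForm_k0High hX.measurable hn hn0 hT hα hα2 hbound,
    fun hα => LevyConv.hasConvolutionForm_k0Low hX.measurable hn hn0 hT hα0 hα hbound⟩
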